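/- All algebras are finite-dimensional over a field $K$, and $D=\operatorname{Hom}_K(-,K)$. For a finite-dimensional (right or left) module $M$ over such an algebra, with minimal injective resolution $0\to M\to I_0\to I_1\to\cdots$, the dominant dimension $\operatorname{domdim}(M)\in\{0,1,2,\dots,\infty\}$ is the supremum of all $n\ge 0$ such that $I_0,\dots,I_{n-1}$ are projective, and $\operatorname{codomdim}(M):=\operatorname{domdim}(D(M))$. The module $M$ over an algebra $A$ is Gorenstein projective if $\operatorname{Ext}^i(M,A)=0=\operatorname{Ext}^i(\operatorname{Tr}M,A)$ for all $i\ge 1$, where $\operatorname{Tr}M$ is the cokernel of $\operatorname{Hom}_A(P_0,A)\to\operatorname{Hom}_A(P_1,A)$ for a minimal projective presentation $P_1\to P_0\to M\to 0$; it is Gorenstein injective if $D(M)$ is Gorenstein projective, and Gorenstein projective-injective if it is both. An algebra $A$ is gendo-symmetric if $\operatorname{domdim}(A_A)\ge 2$ and $D(Ae)\cong eA$ as $(eAe,A)$-bimodules, where $e\in A$ is an idempotent such that $eA$ is a minimal faithful projective-injective right $A$-module (minimal faithful: faithful and a direct summand of every finitely generated faithful module). It has Gorenstein dimension $g\in\mathbb{N}$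 if the injective dimensions of $A$ as a right module and as a left module over itself are both equal to $g$. It is selfinjective if $A_A$ is injective. **Proposition.** Let $A$ be a gendo-symmetric, nonselfinjective, finite-dimensional $K$-algebra of Gorenstein dimension $g$. For every finite-dimensional right $A$-module $M$ the following are equivalent: 1. $M$ is Gorenstein projective-injective; 2. $\operatorname{domdim}(M)+\operatorname{codomdim}(M)\ge 2g$; 3. $\operatorname{domdim}(M)\ge 2g$; 4. $\operatorname{codomdim}(M)\ge 2g$. -/

import Mathlib

universe u

namespace GendoSymm

open CategoryTheory MulOpposite

section Generic

variable (R : Type u) [Ring R] (M : Type u) [AddCommGroup M] [Module R M]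

/-- A submodule is essential if it meets every nonzero submodule nontrivially. -/
def IsEssential {R : Type u} [Ring R] {M : Type u} [AddCommGroup M] [Module R M]
    (N : Submodule R M) : Prop :=
  ∀ L : Submodule R M, N ⊓ L = ⊥ → L = ⊥

/-- A submodule `N` is superfluous if `N + L = M` forces `L = M`. -/
def IsSuperfluous {R : Type u} [Ring R] {M : Type u} [AddCommGroup M] [Module R M]
    (N : Submodule R M) : Prop :=
  ∀ L : Submodule R M, N ⊔ L = ⊤ → L = ⊤

/-- A minimal injective (co)resolution `0 → M → I 0 → I 1 → ⋯`: an exact sequence of injective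
modules in which `M ↪ I 0` and each `im (I n → I (n+1)) ↪ I (n+1)` is essential. -/
structure MinInjResolution where
  I : ℕ → ModuleCat.{u} R
  injective : ∀ n, Module.Injective R (I n)
  ι : M →ₗ[R] I 0
  d : ∀ n, I n →ₗ[R] I (n + 1)
  ι_injective : Function.Injective ι
  exact_zero : Function.Exact ι (d 0)
  exact_succ : ∀ n, Function.Exact (d n) (d (n + 1))
  essential_zero : IsEssential (LinearMap.range ι)
  essential_succ : ∀ n, IsEssential (LinearMap.range (d n))

/-- The dominant dimension of `M`: the supremum of all `n` such that the first `n` terms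
`I 0, …, I (n-1)` of a minimal injective resolution of `M` are projective (it is `0` if `I 0` is
not projective). Minimal injective resolutions are unique up to isomorphism. -/
noncomputable def domdim : ℕ∞ :=
  ⨆ (n : ℕ) (_ : ∃ E : MinInjResolution R M, ∀ i < n, Module.Projective R (E.I i)), (n : ℕ∞)

/-- A minimal projective presentation `P₁ → P₀ → M → 0` by finitely generated projectives:
`P₀ → M` and `P₁ → ker (P₀ → M)` are projective covers. -/
structure MinProjPresentation where
  P₀ : ModuleCat.{u} R
  P₁ : ModuleCat.{u} R
  finite₀ : Module.Finite R P₀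
  finite₁ : Module.Finite R P₁
  projective₀ : Module.Projective R P₀
  projective₁ : Module.Projective R P₁
  π : P₀ →ₗ[R] M
  d : P₁ →ₗ[R] P₀
  π_surjective : Function.Surjective π
  exact : Function.Exact d π
  superfluous₀ : IsSuperfluous (LinearMap.ker π)
  superfluous₁ : IsSuperfluous (LinearMap.ker d)

/-- `Ext^i_R(M, N) = 0` for all `i ≥ 1`. -/
def ExtVanishes (N : Type u) [AddCommGroup N] [Module R N] : Prop :=
  ∀ i : ℕ, 1 ≤ i → Subsingleton (Abelian.Ext (ModuleCat.of R M) (ModuleCat.of R N) i)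

variable (S : Type u) [Ring S] (U : Type u) [AddCommGroup U] [Module R U] [Module S U]
  [SMulCommClass R S U]

/-- The transpose: the cokernel of `Hom_R(P₀, U) → Hom_R(P₁, U)` as an `S`-module, where
`U` is an `R`-`S`-bimodule. It is used for `U = A` the regular bimodule, with `R` and `S` acting
on the two sides. -/
abbrev Transpose {R : Type u} [Ring R] {M : Type u} [AddCommGroup M] [Module R M]
    (S : Type u) [Ring S] (U : Type u) [AddCommGroup U] [Module R U] [Module S U]
    [SMulCommClass R S U] (p : MinProjPresentation R M) : Type u :=
  (p.P₁ →ₗ[R] U) ⧸ LinearMap.range (LinearMap.lcomp S U p.d)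

/-- `Ext^i(M, U) = 0 = Ext^i(Tr M, U)` for all `i ≥ 1`, for `U` the regular bimodule. -/
def IsGProj : Prop :=
  ExtVanishes R M U ∧
    ∃ p : MinProjPresentation R M, ExtVanishes S (Transpose S U p) U

/-- A minimal faithful module: a faithful module that is a direct summand of every
finitely generated faithful module. -/
def IsMinimalFaithful : Prop :=
  FaithfulSMul R M ∧
    ∀ (N : Type u) [AddCommGroup N] [Module R N], Module.Finite R N → FaithfulSMul R N →
      ∃ (i : M →ₗ[R] N) (p : N →ₗ[R] M), p ∘ₗ i = LinearMap.id

end Generic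

section Dual

variable (K : Type u) [Field K] (A : Type u) [Ring A] [Algebra K A]
  (M : Type u) [AddCommGroup M] [Module K M] [Module Aᵐᵒᵖ M] [IsScalarTower K Aᵐᵒᵖ M]

/-- The standard duality `D(M) = Hom_K(M, K)`. -/
def D (K : Type u) [Field K] (M : Type u) [AddCommGroup M] [Module K M] : Type u := M →ₗ[K] K

/-- The linear form underlying an element of `D(M)`. -/
def D.toLin {K : Type u} [Field K] {M : Type u} [AddCommGroup M] [Module K M] (f : D K M) :
    M →ₗ[K] K := f

noncomputable instance (K : Type u) [Field K] (M : Type u) [AddCommGroup M] [Module K M] :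
    AddCommGroup (D K M) :=
  inferInstanceAs (AddCommGroup (M →ₗ[K] K))

/-- For a right `A`-module `M`, `D(M)` is a left `A`-module by `(a • f) m = f (m a)`. -/
noncomputable instance : Module A (D K M) where
  smul a f := (LinearMap.comp f.toLin (Algebra.lsmul K K M (op a)) : M →ₗ[K] K)
  one_smul f := LinearMap.ext fun m => congrArg f.toLin (one_smul Aᵐᵒᵖ m)
  mul_smul a b f := LinearMap.ext fun m => congrArg f.toLin (mul_smul (op b) (op a) m)
  smul_zero _ := rfl
  smul_add _ _ _ := rfl
  add_smul a b f := LinearMap.ext fun m =>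
    (congrArg f.toLin (add_smul (op a) (op b) m)).trans (map_add f.toLin _ _)
  zero_smul f := LinearMap.ext fun m =>
    (congrArg f.toLin (zero_smul Aᵐᵒᵖ m)).trans (map_zero f.toLin)

theorem D.smul_apply (a : A) (f : D K M) (m : M) :
    (a • f).toLin m = f.toLin (op a • m) := rfl

/-- The codominant dimension of a right `A`-module: the dominant dimension of the left
`A`-module `D(M)`. -/
noncomputable def codomdim : ℕ∞ := domdim A (D K M)

/-- `M` is Gorenstein projective and Gorenstein injective, for a right `A`-module `M`. -/
def IsGorensteinProjectiveInjective : Prop :=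
  IsGProj Aᵐᵒᵖ M A A ∧ IsGProj A (D K M) Aᵐᵒᵖ A

end Dual

section Algebras

variable (K : Type u) [Field K] (A : Type u) [Ring A] [Algebra K A]

/-- The right ideal `eA`, as a right `A`-module. -/
def rightIdeal (e : A) : Submodule Aᵐᵒᵖ A where
  carrier := {y | ∃ a, y = e * a}
  add_mem' := by
    rintro _ _ ⟨a, rfl⟩ ⟨b, rfl⟩
    exact ⟨a + b, (mul_add e a b).symm⟩
  zero_mem' := ⟨0, (mul_zero e).symm⟩
  smul_mem' := by
    rintro c _ ⟨a, rfl⟩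
    exact ⟨a * c.unop, by simp [mul_assoc]⟩

/-- The left ideal `Ae`, as a left `A`-module. -/
def leftIdeal (e : A) : Submodule A A where
  carrier := {z | ∃ a, z = a * e}
  add_mem' := by
    rintro _ _ ⟨a, rfl⟩ ⟨b, rfl⟩
    exact ⟨a + b, (add_mul a b e).symm⟩
  zero_mem' := ⟨0, (zero_mul e).symm⟩
  smul_mem' := by
    rintro c _ ⟨a, rfl⟩
    exact ⟨c * a, by simp [mul_assoc]⟩

/-- For `x = e b e ∈ eAe`, `y ∈ eA`, `a ∈ A`: the element `x y a` of `eA`. -/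
def rightIdeal.act {A : Type u} [Ring A] {e : A} (b : A) (y : rightIdeal A e) (a : A) :
    rightIdeal A e :=
  ⟨(e * b * e) * y * a, ⟨b * e * y * a, by simp [mul_assoc]⟩⟩

/-- For `x = e b e ∈ eAe`, `z ∈ Ae`, `a ∈ A`: the element `a z x` of `Ae`. -/
def leftIdeal.act {A : Type u} [Ring A] {e : A} (a : A) (z : leftIdeal A e) (b : A) :
    leftIdeal A e :=
  ⟨a * z * (e * b * e), ⟨a * z * (e * b), by simp [mul_assoc]⟩⟩

/-- `eA ≅ D(Ae)` as `(eAe, A)`-bimodules, where `D(Ae)` carries the bimodule structure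
`(x f a)(z) = f (a z x)`. -/
def HasBimoduleIso (e : A) : Prop :=
  ∃ φ : rightIdeal A e ≃ₗ[K] Module.Dual K (leftIdeal A e),
    ∀ (b a : A) (y : rightIdeal A e) (z : leftIdeal A e),
      φ (rightIdeal.act b y a) z = φ y (leftIdeal.act a z b)

/-- Gendo-symmetric algebras: the dominant dimension of `A_A` is at least two and, for an
idempotent `e` such that `eA` is a minimal faithful projective-injective right module,
`D(Ae) ≅ eA` as `(eAe, A)`-bimodules. -/
structure IsGendoSymmetric : Prop where
  two_le_domdim : 2 ≤ domdim Aᵐᵒᵖ A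
  exists_idempotent : ∃ e : A, IsIdempotentElem e ∧
    IsMinimalFaithful Aᵐᵒᵖ (rightIdeal A e) ∧
    Module.Projective Aᵐᵒᵖ (rightIdeal A e) ∧
    Module.Injective Aᵐᵒᵖ (rightIdeal A e) ∧
    HasBimoduleIso K A e

/-- `A` is Gorenstein of Gorenstein dimension `g`: the right and the left injective dimension
of the regular module both equal `g`. -/
structure IsGorensteinOfDim (g : ℕ) : Prop where
  right : injectiveDimension (ModuleCat.of Aᵐᵒᵖ A) = g
  left : injectiveDimension (ModuleCat.of A A) = g

/-- `A` is selfinjective: the regular right module is injective. -/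
def IsSelfinjective : Prop := Module.Injective Aᵐᵒᵖ A

end Algebras

end GendoSymm

open CategoryTheory

namespace GendoSymm

/-! The isomorphism `D(Ae) ≅ eA` amounts to a symmetric linear form `l` on `eAe` that pairs `eA` and
`Ae` perfectly (`FaithfulSymmetricCorner`). It makes `Ae` projective-injective, and a finitely
generated module without nonzero submodules killed by `e` embeds into a power of `Ae`. Hence `domdim
N ≥ n` iff `Ext^i(X, N) = 0` for all `i < n` and all `X` with `eX = 0` (`Dom`, `le_domdim_iff`), and
dominant dimensions can be computed by dimension shifting. The data are left-right symmetric, so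
results over an algebra `R` with anti-isomorphic `S` apply to `M` and `D(M)` alike.

Two facts carry the proof. (a) `dom_of_extZ`: `domdim A ≥ 2` is a double centraliser property and
yields `ε : D(A) → A` with kernel and cokernel killed by `e`. If `domdim N ≥ 2` and `Ext^i(D(A), N)
= 0` for `i ≥ 1`, the two short exact sequences of `ε` raise the bound on `domdim N` one step at a
time, so it is infinite. (b) `extZ_self_of_dom`: if `domdim N ≥ g`, then `N` is a `g`-th syzygy and
`Ext^i(N, A) = 0` for `i ≥ 1`; dually `Ext^i(D(A), D(N)) = 0`.

Nonselfinjectivity forces `g ≥ 2`. If `M` has both dimensions at least `g`, then (b) for `M` feeds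
(a) for `D(M)` and conversely, so both are infinite. If only their sum is at least `2g`, passing to
a cosyzygy (of `M` or of `D(M)`) trades one dimension for the other until both reach `g`.

Gorenstein projectives are reflexive, hence have dominant dimension at least 2, and (a) makes both
dimensions of a Gorenstein projective-injective `M` infinite. Conversely, infinite dimensions give
`Ext^i(M, A) = 0 = Ext^i(D(M), A)` by (b). The conditions on transposes follow, as `Tr M` is then
the `A`-dual of the second syzygy and `A` has finite injective dimension on the other side. -/

/-- `Ext^n_R(M, N) = 0`. -/
abbrev ExtZ (R : Type u) [Ring R] (M N : Type u) [AddCommGroup M] [Module R M]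
    [AddCommGroup N] [Module R N] (n : ℕ) : Prop :=
  Subsingleton (Abelian.Ext (ModuleCat.of R M) (ModuleCat.of R N) n)

/-! ### Vanishing of Ext along short exact sequences -/

section ExtSequences

variable {R : Type u} [Ring R] {X M I N : Type u} [AddCommGroup X] [Module R X]
  [AddCommGroup M] [Module R M] [AddCommGroup I] [Module R I] [AddCommGroup N] [Module R N]

theorem extZ_zero_iff : ExtZ R M N 0 ↔ ∀ f : M →ₗ[R] N, f = 0 := by
  constructor
  · intro h f
    have : Subsingleton (ModuleCat.of R M ⟶ ModuleCat.of R N) :=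
      Abelian.Ext.homEquiv₀.symm.subsingleton
    have h0 : ModuleCat.ofHom f = 0 := Subsingleton.elim _ _
    exact congrArg ModuleCat.Hom.hom h0
  · intro h
    have : Subsingleton (ModuleCat.of R M ⟶ ModuleCat.of R N) :=
      ⟨fun a b => ModuleCat.hom_ext ((h a.hom).trans (h b.hom).symm)⟩
    exact Abelian.Ext.homEquiv₀.subsingleton

theorem extZ_of_projective [Module.Projective R M] (n : ℕ) : ExtZ R M N (n + 1) := by
  have : Projective (ModuleCat.of R M) := (IsProjective.iff_projective M).1 inferInstance
  exact Abelian.Ext.subsingleton_of_projective _ _ n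

theorem extZ_of_injective (hN : Module.Injective R N) (n : ℕ) : ExtZ R M N (n + 1) := by
  have : Injective (ModuleCat.of R N) := Module.injective_object_of_injective_module R N
  exact Abelian.Ext.subsingleton_of_injective _ _ n

theorem extZ_congr {M' N' : Type u} [AddCommGroup M'] [Module R M'] [AddCommGroup N'] [Module R N']
    (e : M ≃ₗ[R] M') (e' : N ≃ₗ[R] N') {n : ℕ} (h : ExtZ R M N n) : ExtZ R M' N' n := by
  refine ⟨fun a b => ?_⟩
  have key : ∀ (i : ModuleCat.of R M ≅ ModuleCat.of R M') (j : ModuleCat.of R N ≅ ModuleCat.of R N')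
      (c : Abelian.Ext (ModuleCat.of R M') (ModuleCat.of R N') n), c = 0 := by
    intro i j c
    have h1 : ((Abelian.Ext.mk₀ i.hom).comp c (zero_add n)).comp
        (Abelian.Ext.mk₀ j.inv) (add_zero n) = 0 := Subsingleton.elim _ _
    have h2 : (Abelian.Ext.mk₀ i.inv).comp ((((Abelian.Ext.mk₀ i.hom).comp c (zero_add n)).comp
        (Abelian.Ext.mk₀ j.inv) (add_zero n)).comp
        (Abelian.Ext.mk₀ j.hom) (add_zero n)) (zero_add n) = c := by simp
    rw [← h2, h1]
    simp
  rw [key e.toModuleIso e'.toModuleIso a, key e.toModuleIso e'.toModuleIso b]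

variable {f : M →ₗ[R] I} {g : I →ₗ[R] N}

/-- The short exact sequence `0 → M → I → N → 0` in the category of modules. -/
theorem shortExact_of (hf : Function.Injective f) (hfg : Function.Exact f g)
    (hg : Function.Surjective g) :
    (ShortComplex.mk (ModuleCat.ofHom f) (ModuleCat.ofHom g)
      (ModuleCat.hom_ext hfg.linearMap_comp_eq_zero)).ShortExact where
  exact := (ShortComplex.ShortExact.moduleCat_exact_iff_function_exact _).2 hfg
  mono_f := (ModuleCat.mono_iff_injective _).2 hf
  epi_g := (ModuleCat.epi_iff_surjective _).2 hg

theorem extZ_cov_left (hf : Function.Injective f) (hfg : Function.Exact f g)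
    (hg : Function.Surjective g) {n : ℕ} (h0 : ExtZ R X N n) (h1 : ExtZ R X I (n + 1)) :
    ExtZ R X M (n + 1) := by
  refine subsingleton_of_forall_eq 0 fun x => ?_
  obtain ⟨y, rfl⟩ := Abelian.Ext.covariant_sequence_exact₁ (ModuleCat.of R X)
    (shortExact_of hf hfg hg) x (Subsingleton.elim _ _) rfl
  rw [@Subsingleton.elim _ h0 y 0, Abelian.Ext.zero_comp]

theorem extZ_cov_right (hf : Function.Injective f) (hfg : Function.Exact f g)
    (hg : Function.Surjective g) {n : ℕ} (h0 : ExtZ R X I n) (h1 : ExtZ R X M (n + 1)) :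
    ExtZ R X N n := by
  refine subsingleton_of_forall_eq 0 fun x => ?_
  obtain ⟨y, rfl⟩ := Abelian.Ext.covariant_sequence_exact₃ (ModuleCat.of R X)
    (shortExact_of hf hfg hg) x rfl (Subsingleton.elim _ _)
  rw [@Subsingleton.elim _ h0 y 0, Abelian.Ext.zero_comp]

theorem extZ_contra_left (hf : Function.Injective f) (hfg : Function.Exact f g)
    (hg : Function.Surjective g) {n : ℕ} (h0 : ExtZ R I X n) (h1 : ExtZ R N X (n + 1)) :
    ExtZ R M X n := by
  refine subsingleton_of_forall_eq 0 fun x => ?_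
  obtain ⟨y, rfl⟩ := Abelian.Ext.contravariant_sequence_exact₁
    (shortExact_of hf hfg hg) (ModuleCat.of R X) x (add_comm 1 n) (Subsingleton.elim _ _)
  rw [@Subsingleton.elim _ h0 y 0, Abelian.Ext.comp_zero]

theorem extZ_contra_right (hf : Function.Injective f) (hfg : Function.Exact f g)
    (hg : Function.Surjective g) {n : ℕ} (h0 : ExtZ R M X n) (h1 : ExtZ R I X (n + 1)) :
    ExtZ R N X (n + 1) := by
  refine subsingleton_of_forall_eq 0 fun x => ?_
  obtain ⟨y, rfl⟩ := Abelian.Ext.contravariant_sequence_exact₃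
    (shortExact_of hf hfg hg) (ModuleCat.of R X) x (Subsingleton.elim _ _) (add_comm 1 n)
  rw [@Subsingleton.elim _ h0 y 0, Abelian.Ext.comp_zero]

theorem exists_extend_of_extZ (hf : Function.Injective f) (hfg : Function.Exact f g)
    (hg : Function.Surjective g) (h : ExtZ R N X 1) (k : M →ₗ[R] X) :
    ∃ l : I →ₗ[R] X, l ∘ₗ f = k := by
  obtain ⟨y, hy⟩ := Abelian.Ext.contravariant_sequence_exact₁
    (shortExact_of hf hfg hg) (ModuleCat.of R X) (Abelian.Ext.mk₀ (ModuleCat.ofHom k)) rfl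
    (Subsingleton.elim _ _)
  obtain ⟨l, rfl⟩ := Abelian.Ext.mk₀_bijective _ _ |>.2 y
  rw [Abelian.Ext.mk₀_comp_mk₀] at hy
  exact ⟨l.hom, congrArg ModuleCat.Hom.hom ((Abelian.Ext.mk₀_bijective _ _).1 hy)⟩

/-- As `I` is injective, every extension class comes from a map `X → N` through the connecting
homomorphism, which kills the maps that lift to `I`. -/
theorem extZ_one_of_lift (hI : Module.Injective R I) (hf : Function.Injective f)
    (hfg : Function.Exact f g) (hg : Function.Surjective g)
    (h : ∀ k : X →ₗ[R] N, ∃ l : X →ₗ[R] I, g ∘ₗ l = k) : ExtZ R X M 1 := by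
  refine subsingleton_of_forall_eq 0 fun x => ?_
  have := extZ_of_injective (R := R) (M := X) hI 0
  obtain ⟨y, rfl⟩ := Abelian.Ext.covariant_sequence_exact₁ (ModuleCat.of R X)
    (shortExact_of hf hfg hg) x (Subsingleton.elim _ _) rfl
  obtain ⟨k, rfl⟩ := Abelian.Ext.mk₀_bijective _ _ |>.2 y
  obtain ⟨l, hl⟩ := h k.hom
  have hk : k = ModuleCat.ofHom l ≫ ModuleCat.ofHom g := ModuleCat.hom_ext hl.symm
  have := (shortExact_of hf hfg hg).comp_extClass
  rw [hk, ← Abelian.Ext.mk₀_comp_mk₀, Abelian.Ext.comp_assoc_of_second_deg_zero]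
  erw [this, Abelian.Ext.comp_zero]

end ExtSequences

theorem extZ_of_injectiveDimension_le {R : Type u} [Ring R] {U : Type u} [AddCommGroup U]
    [Module R U] {g : ℕ} (h : injectiveDimension (ModuleCat.of R U) = g) (X : Type u)
    [AddCommGroup X] [Module R X] {n : ℕ} (hn : g < n) : ExtZ R X U n := by
  have := (injectiveDimension_le_iff (ModuleCat.of R U) g).1 h.le
  exact HasInjectiveDimensionLT.subsingleton (ModuleCat.of R U) (g + 1) n hn (ModuleCat.of R X)

/-! ### Torsion-freeness and Ext-vanishing relative to an idempotent -/

section Idempotent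

/-- Data of a symmetrising form on `eRe` that pairs `eR` and `Re` perfectly, for an idempotent `e`
such that `eR` and `Re` are faithful. -/
structure FaithfulSymmetricCorner (K : Type u) [Field K] (R : Type u) [Ring R] [Algebra K R]
    (e : R) (l : R →ₗ[K] K) : Prop where
  idem : e * e = e
  map_mul_e : ∀ a, l (a * e) = l a
  map_e_mul : ∀ a, l (e * a) = l a
  symm : ∀ x y, l (x * e * y) = l (y * e * x)
  rep_left : ∀ ψ : R →ₗ[K] K, (∀ r, ψ (e * r) = ψ r) → ∃ z, ∀ r, ψ r = l (r * z)
  rep_right : ∀ ψ : R →ₗ[K] K, (∀ r, ψ (r * e) = ψ r) → ∃ y, ∀ r, ψ r = l (y * r)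
  nondeg_left : ∀ z, (∀ r, l (r * z) = 0) → z * e = 0
  nondeg_right : ∀ y, (∀ r, l (y * r) = 0) → e * y = 0
  faithful_left : ∀ a, (∀ b, e * b * a = 0) → a = 0
  faithful_right : ∀ a, (∀ b, a * b * e = 0) → a = 0

/-- The double centraliser property of `e`, in terms of the symmetrising form. -/
def DoubleCentralizer {K : Type u} [Field K] {R : Type u} [Ring R] [Algebra K R]
    (e : R) (l : R →ₗ[K] K) : Prop :=
  ∀ B : R →ₗ[K] R →ₗ[K] K, (∀ y r, B (e * y) r = B y r) → (∀ y r, B y (r * e) = B y r) →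
    (∀ x y r, B (x * e * y) r = B y (r * e * x)) → ∃ a, ∀ y r, B y r = l (y * a * r)

/-- No nonzero submodule of `N` is annihilated by `e`. -/
def TorsionFree {R : Type u} [Ring R] (e : R) (N : Type u) [AddCommGroup N] [Module R N] : Prop :=
  ∀ x : N, (∀ r : R, (e * r) • x = 0) → x = 0

/-- `Ext^i(X, N) = 0` for all `i < n` and all `X` with `eX = 0`. -/
def Dom {R : Type u} [Ring R] (e : R) (n : ℕ) (N : Type u) [AddCommGroup N] [Module R N] : Prop :=
  ∀ X : ModuleCat.{u} R, (∀ x : X, e • x = 0) → ∀ i < n, ExtZ R X N i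

variable {R : Type u} [Ring R] {e : R} {M I N : Type u}
  [AddCommGroup M] [Module R M] [AddCommGroup I] [Module R I] [AddCommGroup N] [Module R N]

theorem TorsionFree.of_injective (h : TorsionFree e I) (f : M →ₗ[R] I)
    (hf : Function.Injective f) : TorsionFree e M := fun _ hx =>
  hf <| by rw [map_zero]; exact h _ fun r => by rw [← map_smul, hx, map_zero]

theorem TorsionFree.pi {ι : Type} {N : ι → Type u} [∀ i, AddCommGroup (N i)]
    [∀ i, Module R (N i)] (h : ∀ i, TorsionFree e (N i)) :
    TorsionFree (R := R) e (∀ i, N i) := fun _ hx =>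
  funext fun i => h i _ fun r => congrFun (hx r) i

theorem TorsionFree.finsupp {ι : Type u} (h : TorsionFree e N) : TorsionFree e (ι →₀ N) :=
  fun _ hx => Finsupp.ext fun i => h _ fun r => DFunLike.congr_fun (hx r) i

/-- The cyclic submodule `Rx` is killed by `e` exactly when `eRx = 0`, so the cyclic submodules
suffice as test modules. -/
theorem dom_one_iff : Dom e 1 N ↔ TorsionFree e N := by
  constructor
  · intro h x hx
    have h0 := h (ModuleCat.of R (Submodule.span R {x})) (by
      rintro ⟨y, hy⟩
      obtain ⟨r, rfl⟩ := Submodule.mem_span_singleton.1 hy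
      ext
      simpa [mul_smul] using hx r) 0 one_pos
    have := extZ_zero_iff.1 h0 (Submodule.subtype _)
    exact DFunLike.congr_fun this ⟨x, Submodule.mem_span_singleton_self x⟩
  · intro h X hX i hi
    obtain rfl : i = 0 := by omega
    refine extZ_zero_iff.2 fun f => LinearMap.ext fun x => h _ fun r => ?_
    rw [mul_smul, ← map_smul, ← map_smul, hX, map_zero]

theorem Dom.mono {m n : ℕ} (h : Dom e n N) (hmn : m ≤ n) : Dom e m N :=
  fun X hX i hi => h X hX i (by omega)

theorem Dom.congr {n : ℕ} (h : Dom e n M) (φ : M ≃ₗ[R] N) : Dom e n N :=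
  fun X hX i hi => extZ_congr (LinearEquiv.refl R X) φ (h X hX i hi)

theorem TorsionFree.dom_of_injective (h : TorsionFree e I) (hI : Module.Injective R I) (n : ℕ) :
    Dom e n I := fun X hX i _ => by
  rcases i with _ | i
  · exact dom_one_iff.2 h X hX 0 one_pos
  · exact extZ_of_injective hI i

variable {f : M →ₗ[R] I} {g : I →ₗ[R] N}

theorem Dom.of_cosyzygy {n : ℕ} (hI : Dom e (n + 1) I) (hf : Function.Injective f)
    (hfg : Function.Exact f g) (hg : Function.Surjective g) (h : Dom e n N) :
    Dom e (n + 1) M := fun X hX i hi => by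
  rcases i with _ | i
  · refine dom_one_iff.2 (TorsionFree.of_injective (dom_one_iff.1 (hI.mono (by omega))) f hf)
      X hX 0 one_pos
  · exact extZ_cov_left hf hfg hg (h X hX i (by omega)) (hI X hX (i + 1) hi)

theorem Dom.cosyzygy {n : ℕ} (hI : Dom e n I) (hf : Function.Injective f)
    (hfg : Function.Exact f g) (hg : Function.Surjective g) (h : Dom e (n + 1) M) :
    Dom e n N := fun X hX i hi =>
  extZ_cov_right hf hfg hg (hI X hX i hi) (h X hX (i + 1) (by omega))

theorem exact_mkQ_range (f : M →ₗ[R] I) : Function.Exact f (LinearMap.range f).mkQ :=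
  LinearMap.exact_iff.2 (Submodule.ker_mkQ _)

end Idempotent

/-! ### The projective-injective module `Re` and the double centraliser property -/

namespace FaithfulSymmetricCorner

variable {K : Type u} [Field K] {R : Type u} [Ring R] [Algebra K R] {e : R} {l : R →ₗ[K] K}

theorem e_mul_e_mul (h : FaithfulSymmetricCorner K R e l) (a : R) : e * (e * a) = e * a := by
  rw [← mul_assoc, h.idem]

theorem mul_e_of_mem (h : FaithfulSymmetricCorner K R e l) (z : leftIdeal R e) :
    (z : R) * e = z := by
  obtain ⟨z, a, rfl⟩ := z
  simp [mul_assoc, h.idem]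

theorem mul_e_mem (z : R) : z * e ∈ leftIdeal R e := ⟨z, rfl⟩

theorem torsionFree_self (h : FaithfulSymmetricCorner K R e l) : TorsionFree e R :=
  fun x hx => h.faithful_left x hx

theorem torsionFree_leftIdeal (h : FaithfulSymmetricCorner K R e l) :
    TorsionFree e (leftIdeal R e) :=
  h.torsionFree_self.of_injective (Submodule.subtype _) (Submodule.subtype_injective _)

theorem torsionFree_of_projective (h : FaithfulSymmetricCorner K R e l) {P : Type u}
    [AddCommGroup P] [Module R P] [Module.Projective R P] : TorsionFree e P := by
  obtain ⟨s, hs⟩ := Module.projective_def'.1 ‹Module.Projective R P›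
  refine (h.torsionFree_self.finsupp (ι := P)).of_injective s ?_
  exact Function.LeftInverse.injective (g := Finsupp.linearCombination R id)
    fun x => DFunLike.congr_fun hs x

theorem projective_leftIdeal (h : FaithfulSymmetricCorner K R e l) :
    Module.Projective R (leftIdeal R e) := by
  refine Module.Projective.of_split (Submodule.subtype _)
    ((LinearMap.toSpanSingleton R R e).codRestrict _ fun x => ⟨x, rfl⟩) ?_
  ext z
  exact h.mul_e_of_mem z

/-- A `K`-linear form on `X` that factors through `eX` is represented by a map `X → Re`. -/
theorem exists_linearMap (h : FaithfulSymmetricCorner K R e l) {X : Type u} [AddCommGroup X]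
    [Module R X] [Module K X] [IsScalarTower K R X] (ξ : X →ₗ[K] K) (hξ : ∀ x, ξ (e • x) = ξ x) :
    ∃ f : X →ₗ[R] leftIdeal R e, ∀ x, l (f x) = ξ x := by
  have ex : ∀ x, ∃ z : leftIdeal R e, ∀ r : R, ξ (r • x) = l (r * z) := by
    intro x
    obtain ⟨z, hz⟩ := h.rep_left (ξ ∘ₗ (LinearMap.toSpanSingleton R X x).restrictScalars K)
      (fun r => by simp [mul_smul, hξ])
    refine ⟨⟨z * e, mul_e_mem z⟩, fun r => ?_⟩
    rw [← mul_assoc, h.map_mul_e]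
    exact hz r
  have uniq : ∀ z w : leftIdeal R e, (∀ r : R, l (r * z) = l (r * w)) → z = w := by
    intro z w hzw
    have := h.nondeg_left (z - w : R) fun r => by rw [mul_sub, map_sub, hzw, sub_self]
    rw [sub_mul, h.mul_e_of_mem, h.mul_e_of_mem, sub_eq_zero] at this
    exact Subtype.ext this
  choose F hF using ex
  refine ⟨⟨⟨F, fun x y => uniq _ _ fun r => ?_⟩, fun s x => uniq _ _ fun r => ?_⟩, fun x => ?_⟩
  · simp only [← hF, smul_add, map_add, Submodule.coe_add, mul_add]
  · simp [← hF, smul_smul, ← mul_assoc]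
  · simpa using (hF x 1).symm

/-- Maps `X → Re` correspond to `K`-linear forms on `eX`, and linear forms extend along injections.
-/
theorem injective_leftIdeal (h : FaithfulSymmetricCorner K R e l) :
    Module.Injective R (leftIdeal R e) := by
  refine ⟨fun X Y _ _ _ _ f hf g => ?_⟩
  let _ : Module K X := Module.compHom X (algebraMap K R)
  let _ : Module K Y := Module.compHom Y (algebraMap K R)
  have : IsScalarTower K R X := IsScalarTower.of_algebraMap_smul fun _ _ => rfl
  have : IsScalarTower K R Y := IsScalarTower.of_algebraMap_smul fun _ _ => rfl
  obtain ⟨r, hr⟩ := LinearMap.exists_leftInverse_of_injective (f.restrictScalars K)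
    (LinearMap.ker_eq_bot.2 hf)
  obtain ⟨k, hk⟩ := h.exists_linearMap (X := Y)
    (l ∘ₗ ((Submodule.subtype _ ∘ₗ g).restrictScalars K) ∘ₗ r ∘ₗ
      (Module.toModuleEnd K (S := R) Y e)) (fun x => by simp [smul_smul, h.idem])
  refine ⟨k, fun x => ?_⟩
  have key : ∀ s, l (s * k (f x)) = l (s * g x) := by
    intro s
    have h1 := hk (s • f x)
    have h2 : r (e • s • f x) = e • s • x := by
      rw [← map_smul, ← map_smul]
      exact DFunLike.congr_fun hr _
    simp [h2] at h1
    rw [h1, h.map_e_mul]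
  have := h.nondeg_left (k (f x) - g x : R) fun r => by rw [mul_sub, map_sub, key, sub_self]
  rw [sub_mul, h.mul_e_of_mem, h.mul_e_of_mem, sub_eq_zero] at this
  exact Subtype.ext this

theorem injective_pi_leftIdeal (h : FaithfulSymmetricCorner K R e l) (m : ℕ) :
    Module.Injective R (Fin m → leftIdeal R e) := by
  have := h.injective_leftIdeal
  infer_instance

theorem projective_pi_leftIdeal (h : FaithfulSymmetricCorner K R e l) (m : ℕ) :
    Module.Projective R (Fin m → leftIdeal R e) := by
  have := h.projective_leftIdeal
  exact Module.Projective.of_equiv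
    (DFinsupp.linearEquivFunOnFintype (R := R) (M := fun _ : Fin m => leftIdeal R e))

theorem torsionFree_pi_leftIdeal (h : FaithfulSymmetricCorner K R e l) (m : ℕ) :
    TorsionFree e (Fin m → leftIdeal R e) :=
  TorsionFree.pi fun _ => h.torsionFree_leftIdeal

theorem dom_pi_leftIdeal (h : FaithfulSymmetricCorner K R e l) (m n : ℕ) :
    Dom e n (Fin m → leftIdeal R e) :=
  (h.torsionFree_pi_leftIdeal m).dom_of_injective (h.injective_pi_leftIdeal m) n

/-- A finitely generated torsion-free module embeds into a finite power of `Re`. -/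
theorem exists_embedding (h : FaithfulSymmetricCorner K R e l) [FiniteDimensional K R]
    {N : Type u} [AddCommGroup N] [Module R N] [Module.Finite R N] (hN : TorsionFree e N) :
    ∃ (m : ℕ) (f : N →ₗ[R] (Fin m → leftIdeal R e)), Function.Injective f := by
  let _ : Module K N := Module.compHom N (algebraMap K R)
  have : IsScalarTower K R N := IsScalarTower.of_algebraMap_smul fun _ _ => rfl
  have : Module.Finite K N := Module.Finite.trans R N
  -- The forms `x ↦ b j (e • x)` give maps to `Re` whose common kernel consists of the `x` with `eRx
  -- = 0`.
  let b := Module.finBasis K (Module.Dual K N)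
  have ex : ∀ j, ∃ f : N →ₗ[R] leftIdeal R e, ∀ x, l (f x) = b j (e • x) := fun j => by
    obtain ⟨f, hf⟩ := h.exists_linearMap (X := N) (b j ∘ₗ (Module.toModuleEnd K (S := R) N e))
      (fun x => by simp [smul_smul, h.idem])
    exact ⟨f, hf⟩
  choose f hf using ex
  refine ⟨_, LinearMap.pi f, (injective_iff_map_eq_zero _).2 fun x hx => hN x fun r => ?_⟩
  refine (Module.forall_dual_apply_eq_zero_iff K _).1 fun φ => ?_
  have : ∀ j, b j ((e * r) • x) = 0 := fun j => by
    rw [mul_smul, ← hf, map_smul, show f j x = 0 from congrFun hx j, smul_zero]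
    simp
  rw [← b.sum_repr φ, LinearMap.sum_apply]
  exact Finset.sum_eq_zero fun j _ => by rw [LinearMap.smul_apply, this, smul_zero]

theorem projective_of_injective (h : FaithfulSymmetricCorner K R e l) [FiniteDimensional K R]
    {I : Type u} [AddCommGroup I] [Module R I] [Module.Finite R I] (hI : Module.Injective R I)
    (ht : TorsionFree e I) : Module.Projective R I := by
  obtain ⟨m, f, hf⟩ := h.exists_embedding ht
  obtain ⟨p, hp⟩ := hI.out f hf LinearMap.id
  have := h.projective_pi_leftIdeal m
  exact Module.Projective.of_split f p (LinearMap.ext hp)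

/-- A module with `Dom e (n + 1)` has a cosyzygy with respect to a finite power of `Re`. -/
theorem exists_cosyzygy (h : FaithfulSymmetricCorner K R e l) [FiniteDimensional K R]
    {N : Type u} [AddCommGroup N] [Module R N] [Module.Finite R N] {n : ℕ} (hN : Dom e (n + 1) N) :
    ∃ (m : ℕ) (f : N →ₗ[R] (Fin m → leftIdeal R e)), Function.Injective f ∧
      Dom e n ((Fin m → leftIdeal R e) ⧸ LinearMap.range f) := by
  obtain ⟨m, f, hf⟩ := h.exists_embedding (dom_one_iff.1 (hN.mono (by omega)))
  exact ⟨m, f, hf, (h.dom_pi_leftIdeal m n).cosyzygy hf (exact_mkQ_range f)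
    (Submodule.mkQ_surjective _) hN⟩

/-- Embed `R` into `(Re)^m` with torsion-free cokernel. Representing `B` against the coordinates of
`f 1` gives a vector `w` with `eRw` inside the image of `f`; torsion-freeness puts `w = f a` in the
image, and `a` represents `B`. -/
theorem doubleCentralizer_of_dom (h : FaithfulSymmetricCorner K R e l) [FiniteDimensional K R]
    (hR : Dom e 2 R) : DoubleCentralizer e l := by
  intro B h1 h2 h3
  obtain ⟨m, f, hf, hC⟩ := h.exists_cosyzygy hR
  have hC := dom_one_iff.1 hC
  have fapp : ∀ (a : R) (j), (f a j : R) = a * f 1 j := fun a j => by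
    have : f a = a • f 1 := by rw [← map_smul, smul_eq_mul, mul_one]
    rw [this]
    rfl
  have hw : ∀ j, ∃ w : leftIdeal R e, ∀ y, B y (f 1 j) = l (y * w) := fun j => by
    obtain ⟨w, hw⟩ := h.rep_left (B.flip (f 1 j)) (fun r => h1 _ _)
    exact ⟨⟨w * e, mul_e_mem w⟩, fun y => by rw [← mul_assoc, h.map_mul_e]; exact hw y⟩
  have hu : ∀ y, ∃ u, e * u = u ∧ ∀ r, B y r = l (u * r) := fun y => by
    obtain ⟨u, hu⟩ := h.rep_right (B y) (h2 y)
    exact ⟨e * u, h.e_mul_e_mul u, fun r => by rw [mul_assoc, h.map_e_mul]; exact hu r⟩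
  choose w hw using hw
  choose u heu hu using hu
  have key : ∀ r, (e * r) • w = f (u r) := fun r => by
    funext j
    apply Subtype.ext
    rw [fapp]
    have := h.nondeg_left (e * r * w j - u r * f 1 j) fun x => by
      have : x * (u r * (f 1 j : R)) = x * e * (u r * f 1 j) := by
        rw [← mul_assoc, ← mul_assoc (x * e), mul_assoc x e, heu]
      rw [mul_sub, map_sub, this, h.symm, ← mul_assoc, ← mul_assoc, ← hw, h3, hu, mul_assoc (u r),
        mul_assoc (u r), mul_assoc, sub_self]
    rw [sub_mul, mul_assoc, h.mul_e_of_mem, mul_assoc (u r), h.mul_e_of_mem, sub_eq_zero] at this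
    exact this
  have hmem : (LinearMap.range f).mkQ w = 0 := hC _ fun r => by
    rw [← map_smul, key]
    simp
  obtain ⟨a, ha⟩ : w ∈ LinearMap.range f := by simpa using hmem
  refine ⟨a, fun y r => ?_⟩
  have : u y = e * y * a := hf <| by
    rw [← key, ← ha, ← map_smul, smul_eq_mul]
  rw [hu, this, mul_assoc, mul_assoc, h.map_e_mul, mul_assoc]

/-- Converse of the preceding argument: a vector `w` with `eRw` in the image of `R` defines a
balanced form, whose representing element `a` satisfies `f a = w`. Thus the cokernel is
torsion-free. -/
theorem dom_of_doubleCentralizer (h : FaithfulSymmetricCorner K R e l) [FiniteDimensional K R]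
    (hD : DoubleCentralizer e l) : Dom e 2 R := by
  obtain ⟨m, f, hf⟩ := h.exists_embedding h.torsionFree_self
  refine (h.dom_pi_leftIdeal m 2).of_cosyzygy hf (exact_mkQ_range f)
    (Submodule.mkQ_surjective _) (dom_one_iff.2 fun w hw => ?_)
  obtain ⟨w, rfl⟩ := Submodule.mkQ_surjective _ w
  have ex : ∀ y, ∃ u, f u = (e * y) • w := fun y => by
    have := hw y
    rwa [← map_smul, ← LinearMap.mem_ker, Submodule.ker_mkQ] at this
  choose u hu using ex
  let U : R →ₗ[K] R :=
    { toFun := u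
      map_add' := fun x y => hf <| by simp only [map_add, hu, mul_add, add_smul]
      map_smul' := fun c x => hf <| by
        rw [RingHom.id_apply, ← LinearMap.coe_restrictScalars K f, map_smul,
          LinearMap.coe_restrictScalars, hu, hu, mul_smul_comm, smul_assoc] }
  have heu : ∀ y, e * u y = u y := fun y => hf <| by
    rw [← smul_eq_mul, map_smul, hu, smul_smul, h.e_mul_e_mul]
  obtain ⟨a, ha⟩ := hD ((LinearMap.mul K R).compr₂ l ∘ₗ U) (fun y r => by
      have : u (e * y) = u y := hf <| by rw [hu, hu, h.e_mul_e_mul]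
      simp [U, this])
    (fun y r => by simp [U, ← mul_assoc, h.map_mul_e])
    (fun x y r => by
      have : u (x * e * y) = e * (x * u y) := hf <| by
        rw [hu, ← mul_assoc e x (u y), ← smul_eq_mul (e * x) (u y), map_smul, hu, smul_smul]
        simp only [mul_assoc]
      change l (u (x * e * y) * r) = l (u y * (r * e * x))
      rw [this, mul_assoc, h.map_e_mul, ← heu y, mul_assoc x, mul_assoc e, ← mul_assoc x, h.symm,
        mul_assoc e, h.map_e_mul]
      simp [mul_assoc])
  have hua : ∀ y, u y = e * (y * a) := fun y => by
    have := h.nondeg_right (u y - y * a) fun r => by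
      rw [sub_mul, map_sub, sub_eq_zero]; exact ha y r
    rwa [mul_sub, heu, sub_eq_zero] at this
  have : w - f a = 0 := h.torsionFree_pi_leftIdeal m _ fun r => by
    rw [smul_sub, ← hu, ← map_smul, hua, smul_eq_mul, mul_assoc, sub_self]
  rw [sub_eq_zero] at this
  simp [this]

theorem dom_two_pi (h : FaithfulSymmetricCorner K R e l) [FiniteDimensional K R]
    (hR : Dom e 2 R) (k : ℕ) : Dom e 2 (Fin k → R) := by
  obtain ⟨m, f, hf, hC⟩ := h.exists_cosyzygy hR
  refine Dom.of_cosyzygy (f := LinearMap.pi fun i => f ∘ₗ LinearMap.proj i)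
    (g := LinearMap.pi fun i => (LinearMap.range f).mkQ ∘ₗ LinearMap.proj i)
    (TorsionFree.dom_of_injective (TorsionFree.pi fun _ => h.torsionFree_pi_leftIdeal m)
      (by have := h.injective_pi_leftIdeal m; infer_instance) 2) ?_ ?_ ?_
    (dom_one_iff.2 (TorsionFree.pi fun _ => dom_one_iff.1 hC))
  · exact fun x y hxy => funext fun i => hf (congrFun hxy i)
  · intro x
    constructor
    · intro hx
      have : ∀ i, ∃ y, f y = x i := fun i => by simpa using congrFun hx i
      choose y hy using this
      exact ⟨y, funext hy⟩
    · rintro ⟨y, rfl⟩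
      funext i
      simp
  · intro y
    choose x hx using fun i => Submodule.mkQ_surjective _ (y i)
    exact ⟨x, funext hx⟩

end FaithfulSymmetricCorner

/-! ### The duality `D` between modules over anti-isomorphic algebras -/

section Duality

/-- A `K`-linear anti-isomorphism of algebras. -/
structure AntiIso (K : Type u) [Field K] (R S : Type u) [Ring R] [Algebra K R] [Ring S]
    [Algebra K S] extends R ≃ₗ[K] S where
  map_mul' : ∀ a b, toFun (a * b) = toFun b * toFun a

namespace AntiIso

variable {K : Type u} [Field K] {R S : Type u} [Ring R] [Algebra K R] [Ring S] [Algebra K S]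
  (θ : AntiIso K R S)

theorem map_mul (a b : R) : θ.toLinearEquiv (a * b) = θ.toLinearEquiv b * θ.toLinearEquiv a :=
  θ.map_mul' a b

/-- The inverse anti-isomorphism. -/
def symm : AntiIso K S R where
  toLinearEquiv := θ.toLinearEquiv.symm
  map_mul' a b := θ.toLinearEquiv.injective <| by
    change θ.toLinearEquiv (θ.toLinearEquiv.symm (a * b)) =
      θ.toLinearEquiv (θ.toLinearEquiv.symm b * θ.toLinearEquiv.symm a)
    simp [θ.map_mul]

theorem map_one : θ.toLinearEquiv 1 = 1 := by
  have h := θ.map_mul (θ.toLinearEquiv.symm 1) 1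
  rw [mul_one, LinearEquiv.apply_symm_apply, mul_one] at h
  exact h.symm

theorem apply_symm_apply (s : S) : θ.toLinearEquiv (θ.symm.toLinearEquiv s) = s :=
  θ.toLinearEquiv.apply_symm_apply s

theorem symm_apply_apply (r : R) : θ.symm.toLinearEquiv (θ.toLinearEquiv r) = r :=
  θ.toLinearEquiv.symm_apply_apply r

end AntiIso

variable {K : Type u} [Field K] {R S : Type u} [Ring R] [Algebra K R] [Ring S] [Algebra K S]

/-- The `K`-dual of an `R`-module as a module over an algebra anti-isomorphic to `R`. -/
def DualMod (_ : AntiIso K R S) (M : Type u) [AddCommGroup M] [Module K M] : Type u :=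
  Module.Dual K M

namespace DualMod

variable (θ : AntiIso K R S) (M : Type u) [AddCommGroup M] [Module K M]

noncomputable instance : AddCommGroup (DualMod θ M) :=
  inferInstanceAs (AddCommGroup (Module.Dual K M))

noncomputable instance : Module K (DualMod θ M) :=
  inferInstanceAs (Module K (Module.Dual K M))

instance [FiniteDimensional K M] : FiniteDimensional K (DualMod θ M) :=
  inferInstanceAs (FiniteDimensional K (Module.Dual K M))

variable {θ M} in
/-- The linear form underlying an element of `DualMod θ M`. -/
def toDual (f : DualMod θ M) : Module.Dual K M := f

variable {θ M} in
theorem ext {f g : DualMod θ M} (h : ∀ m, f.toDual m = g.toDual m) : f = g :=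
  LinearMap.ext (f := f.toDual) (g := g.toDual) h

variable [Module R M] [IsScalarTower K R M]

noncomputable instance : Module S (DualMod θ M) where
  smul s f := f.toDual ∘ₗ Algebra.lsmul K K M (θ.symm.toLinearEquiv s)
  one_smul f := ext fun m => by
    change f.toDual (θ.symm.toLinearEquiv 1 • m) = f.toDual m
    rw [θ.symm.map_one, one_smul]
  mul_smul a b f := ext fun m => by
    change f.toDual (θ.symm.toLinearEquiv (a * b) • m) =
      f.toDual (θ.symm.toLinearEquiv b • θ.symm.toLinearEquiv a • m)
    rw [θ.symm.map_mul, mul_smul]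
  smul_zero _ := rfl
  smul_add _ _ _ := rfl
  add_smul a b f := ext fun m => by
    change f.toDual (θ.symm.toLinearEquiv (a + b) • m) =
      f.toDual (θ.symm.toLinearEquiv a • m) + f.toDual (θ.symm.toLinearEquiv b • m)
    rw [map_add, add_smul, map_add]
  zero_smul f := ext fun m => by
    change f.toDual (θ.symm.toLinearEquiv 0 • m) = 0
    rw [map_zero, zero_smul, map_zero]

theorem smul_toDual (s : S) (f : DualMod θ M) (m : M) :
    (s • f).toDual m = f.toDual (θ.symm.toLinearEquiv s • m) := rfl

instance : IsScalarTower K S (DualMod θ M) :=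
  ⟨fun c s f => ext fun m => by
    rw [smul_toDual, _root_.map_smul θ.symm.toLinearEquiv c s, smul_assoc, f.toDual.map_smul]
    rfl⟩

variable {M} {N I : Type u} [AddCommGroup N] [Module K N] [Module R N] [IsScalarTower K R N]
  [AddCommGroup I] [Module K I] [Module R I] [IsScalarTower K R I]

/-- Functoriality of the duality. -/
noncomputable def map (f : M →ₗ[R] N) : DualMod θ N →ₗ[S] DualMod θ M where
  toFun φ := φ.toDual ∘ₗ f.restrictScalars K
  map_add' _ _ := rfl
  map_smul' _ φ := ext fun m => congrArg φ.toDual (f.map_smul _ m).symm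

theorem map_toDual (f : M →ₗ[R] N) (φ : DualMod θ N) (m : M) :
    (map θ f φ).toDual m = φ.toDual (f m) := rfl

theorem map_surjective {f : M →ₗ[R] N} (hf : Function.Injective f) :
    Function.Surjective (map θ f) :=
  LinearMap.dualMap_surjective_of_injective (f := f.restrictScalars K) hf

theorem map_injective {f : M →ₗ[R] N} (hf : Function.Surjective f) :
    Function.Injective (map θ f) :=
  LinearMap.dualMap_injective_of_surjective (f := f.restrictScalars K) hf

theorem map_exact {f : M →ₗ[R] I} {g : I →ₗ[R] N} (hfg : Function.Exact f g)
    (hg : Function.Surjective g) : Function.Exact (map θ g) (map θ f) := by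
  intro φ
  constructor
  · intro h
    have hker : LinearMap.ker (g.restrictScalars K) ≤ LinearMap.ker φ.toDual := by
      intro x hx
      obtain ⟨y, rfl⟩ := (hfg x).1 hx
      exact LinearMap.congr_fun (f := (map θ f φ).toDual) (g := 0) h y
    obtain ⟨s, hs⟩ := (g.restrictScalars K).exists_rightInverse_of_surjective
      (LinearMap.range_eq_top.2 hg)
    refine ⟨φ.toDual ∘ₗ s, ext fun m => ?_⟩
    have : s (g m) - m ∈ LinearMap.ker (g.restrictScalars K) := by
      have := LinearMap.congr_fun hs (g m)
      simp only [LinearMap.coe_comp, Function.comp_apply, LinearMap.coe_restrictScalars,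
        LinearMap.id_apply] at this
      simp [this]
    have := hker this
    rw [LinearMap.mem_ker, map_sub, sub_eq_zero] at this
    exact this
  · rintro ⟨ψ, rfl⟩
    refine ext fun m => ?_
    rw [map_toDual, map_toDual, hfg.apply_apply_eq_zero, map_zero]
    rfl

/-- The canonical isomorphism from a finite-dimensional module to its double dual. -/
noncomputable def evalEquiv (M : Type u) [AddCommGroup M] [Module K M] [Module R M]
    [IsScalarTower K R M] [FiniteDimensional K M] :
    M ≃ₗ[R] DualMod θ.symm (DualMod θ M) :=
  { Module.evalEquiv K M with
    map_smul' := fun r m => ext fun (φ : DualMod θ M) => by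
      change φ.toDual (r • m) = φ.toDual (θ.symm.toLinearEquiv
        (θ.toLinearEquiv r) • m)
      rw [θ.symm_apply_apply] }

theorem evalEquiv_toDual [FiniteDimensional K M] (m : M) (φ : DualMod θ M) :
    (evalEquiv θ M m).toDual φ = φ.toDual m := rfl

variable {X : Type u} [AddCommGroup X] [Module K X] [Module S X] [IsScalarTower K S X]

/-- Exchange of the arguments of a pairing `X × M → K`. -/
noncomputable def transpose (g : X →ₗ[S] DualMod θ M) : M →ₗ[R] DualMod θ.symm X where
  toFun m := (Module.Dual.eval K M m) ∘ₗ (g.restrictScalars K : X →ₗ[K] Module.Dual K M)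
  map_add' x y := ext fun φ => map_add (g φ).toDual x y
  map_smul' r m := ext fun x => by
    change (g x).toDual (r • m) = (g (θ.toLinearEquiv r • x)).toDual m
    rw [g.map_smul, smul_toDual, θ.symm_apply_apply]

theorem transpose_toDual (g : X →ₗ[S] DualMod θ M) (m : M) (x : X) :
    (transpose θ g m).toDual x = (g x).toDual m := rfl

theorem injective_of_projective [Module.Projective R M] :
    Module.Injective S (DualMod θ M) := by
  refine ⟨fun X Y _ _ _ _ f hf g => ?_⟩
  let _ : Module K X := Module.compHom X (algebraMap K S)
  let _ : Module K Y := Module.compHom Y (algebraMap K S)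
  have : IsScalarTower K S X := IsScalarTower.of_algebraMap_smul fun _ _ => rfl
  have : IsScalarTower K S Y := IsScalarTower.of_algebraMap_smul fun _ _ => rfl
  obtain ⟨k, hk⟩ := Module.projective_lifting_property (map θ.symm f) (transpose θ g)
    (map_surjective θ.symm hf)
  refine ⟨transpose θ.symm k, fun x => ext fun m => ?_⟩
  have := LinearMap.congr_fun hk m
  exact LinearMap.congr_fun (f := (map θ.symm f (k m)).toDual) (g := (transpose θ g m).toDual)
    this x

variable {f : M →ₗ[R] I} {g : I →ₗ[R] N}

/-- A map `D(Y) → D(M)` transposes to `M → Y`, which extends to `I` because `Ext^1(N, Y) = 0`;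
dualising the extension lifts the original map to `D(I)`, which is injective. -/
theorem extZ_one_dual [Module.Projective R I] (hf : Function.Injective f)
    (hfg : Function.Exact f g) (hg : Function.Surjective g) {Y : Type u} [AddCommGroup Y]
    [Module K Y] [Module R Y] [IsScalarTower K R Y] [FiniteDimensional K Y] (h : ExtZ R N Y 1) :
    ExtZ S (DualMod θ Y) (DualMod θ N) 1 := by
  refine extZ_one_of_lift (injective_of_projective θ) (map_injective θ hg)
    (map_exact θ hfg hg) (map_surjective θ hf) fun k => ?_
  obtain ⟨l, hl⟩ := exists_extend_of_extZ hf hfg hg h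
    ((evalEquiv θ Y).symm.toLinearMap ∘ₗ transpose θ k)
  refine ⟨map θ l, LinearMap.ext fun φ => ext fun w => ?_⟩
  have h1 : l (f w) = (evalEquiv θ Y).symm (transpose θ k w) := LinearMap.congr_fun hl w
  change φ.toDual (l (f w)) = (k φ).toDual w
  rw [h1, ← evalEquiv_toDual, LinearEquiv.apply_symm_apply, transpose_toDual]

/-- Dimension shifting along the free cover on the underlying set of `X`. That cover need not be
finite-dimensional, so only `Y` is assumed to be. -/
theorem extZ_dual {Y : Type u} [AddCommGroup Y] [Module K Y] [Module R Y] [IsScalarTower K R Y]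
    [FiniteDimensional K Y] (i : ℕ) : ∀ (X : Type u) [AddCommGroup X] [Module K X] [Module R X]
    [IsScalarTower K R X], ExtZ R X Y (i + 1) →
      ExtZ S (DualMod θ Y) (DualMod θ X) (i + 1) := by
  induction i with
  | zero =>
    intro X _ _ _ _ h
    have hp : Function.Surjective (Finsupp.linearCombination R (id : X → X)) :=
      Finsupp.linearCombination_id_surjective R X
    exact extZ_one_dual θ (Submodule.subtype_injective _) (LinearMap.exact_subtype_ker_map _) hp h
  | succ i ih =>
    intro X _ _ _ _ h
    have hp : Function.Surjective (Finsupp.linearCombination R (id : X → X)) :=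
      Finsupp.linearCombination_id_surjective R X
    have hf := Submodule.subtype_injective (LinearMap.ker (Finsupp.linearCombination R (id : X → X)))
    have hex := LinearMap.exact_subtype_ker_map (Finsupp.linearCombination R (id : X → X))
    have h1 := ih (LinearMap.ker (Finsupp.linearCombination R (id : X → X)))
      (extZ_contra_left hf hex hp (extZ_of_projective i) h)
    exact extZ_cov_left (map_injective θ hp) (map_exact θ hex hp) (map_surjective θ hf) h1
      (extZ_of_injective (injective_of_projective θ) (i + 1))

end DualMod

namespace FaithfulSymmetricCorner

variable {e : R} {l : R →ₗ[K] K} (θ : AntiIso K R S)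

/-- The axioms are left-right symmetric, so every later result is available on both sides. -/
theorem dual (h : FaithfulSymmetricCorner K R e l) :
    FaithfulSymmetricCorner K S (θ.toLinearEquiv e) (l ∘ₗ θ.symm.toLinearEquiv.toLinearMap) where
  idem := by rw [← θ.map_mul, h.idem]
  map_mul_e a := by
    obtain ⟨a, rfl⟩ := θ.toLinearEquiv.surjective a
    simp [← θ.map_mul, θ.symm_apply_apply, h.map_e_mul]
  map_e_mul a := by
    obtain ⟨a, rfl⟩ := θ.toLinearEquiv.surjective a
    simp [← θ.map_mul, θ.symm_apply_apply, h.map_mul_e]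
  symm x y := by
    obtain ⟨x, rfl⟩ := θ.toLinearEquiv.surjective x
    obtain ⟨y, rfl⟩ := θ.toLinearEquiv.surjective y
    simp [← θ.map_mul, θ.symm_apply_apply, ← mul_assoc, h.symm]
  rep_left ψ hψ := by
    obtain ⟨y, hy⟩ := h.rep_right (ψ ∘ₗ θ.toLinearEquiv.toLinearMap)
      (fun r => by simp [θ.map_mul, hψ])
    refine ⟨θ.toLinearEquiv y, fun s => ?_⟩
    obtain ⟨s, rfl⟩ := θ.toLinearEquiv.surjective s
    simpa [← θ.map_mul, θ.symm_apply_apply] using hy s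
  rep_right ψ hψ := by
    obtain ⟨y, hy⟩ := h.rep_left (ψ ∘ₗ θ.toLinearEquiv.toLinearMap)
      (fun r => by simp [θ.map_mul, hψ])
    refine ⟨θ.toLinearEquiv y, fun s => ?_⟩
    obtain ⟨s, rfl⟩ := θ.toLinearEquiv.surjective s
    simpa [← θ.map_mul, θ.symm_apply_apply] using hy s
  nondeg_left z hz := by
    obtain ⟨z, rfl⟩ := θ.toLinearEquiv.surjective z
    rw [← θ.map_mul, h.nondeg_right z fun r => ?_, map_zero]
    simpa [← θ.map_mul, θ.symm_apply_apply] using hz (θ.toLinearEquiv r)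
  nondeg_right z hz := by
    obtain ⟨z, rfl⟩ := θ.toLinearEquiv.surjective z
    rw [← θ.map_mul, h.nondeg_left z fun r => ?_, map_zero]
    simpa [← θ.map_mul, θ.symm_apply_apply] using hz (θ.toLinearEquiv r)
  faithful_left a ha := by
    obtain ⟨a, rfl⟩ := θ.toLinearEquiv.surjective a
    rw [h.faithful_right a fun b => ?_, map_zero]
    simpa [← θ.map_mul, mul_assoc] using ha (θ.toLinearEquiv b)
  faithful_right a ha := by
    obtain ⟨a, rfl⟩ := θ.toLinearEquiv.surjective a
    rw [h.faithful_left a fun b => ?_, map_zero]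
    simpa [← θ.map_mul, mul_assoc] using ha (θ.toLinearEquiv b)

/-- The dual of a power of `Re` is torsion-free. -/
theorem torsionFree_dualMod (h : FaithfulSymmetricCorner K R e l) (m : ℕ) :
    TorsionFree (θ.toLinearEquiv e) (DualMod θ (Fin m → leftIdeal R e)) := by
  intro φ hφ
  refine LinearMap.pi_ext (f := φ.toDual) (g := 0) fun j x => ?_
  have h1 : Pi.single j x = ((x : R) * e) •
      (Pi.single j ⟨e, 1, (one_mul e).symm⟩ : Fin m → leftIdeal R e) := by
    rw [← Pi.single_smul]
    congr 1
    ext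
    simp [h.mul_e_of_mem]
  have h2 := LinearMap.congr_fun (f := DualMod.toDual _) (g := 0) (hφ (θ.toLinearEquiv x))
    (Pi.single j ⟨e, 1, (one_mul e).symm⟩)
  rw [DualMod.smul_toDual, ← θ.map_mul, θ.symm_apply_apply, ← h1] at h2
  exact h2

theorem dom_dualMod (h : FaithfulSymmetricCorner K R e l) (m n : ℕ) :
    Dom (θ.toLinearEquiv e) n (DualMod θ (Fin m → leftIdeal R e)) :=
  have := h.projective_pi_leftIdeal m
  (h.torsionFree_dualMod θ m).dom_of_injective (DualMod.injective_of_projective θ) n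

end FaithfulSymmetricCorner

theorem DoubleCentralizer.dual {e : R} {l : R →ₗ[K] K} (θ : AntiIso K R S)
    (h : DoubleCentralizer e l) :
    DoubleCentralizer (θ.toLinearEquiv e) (l ∘ₗ θ.symm.toLinearEquiv.toLinearMap) := by
  intro B h1 h2 h3
  obtain ⟨a, ha⟩ := h ((B.compl₁₂ θ.toLinearEquiv.toLinearMap θ.toLinearEquiv.toLinearMap).flip)
    (fun y r => by simp [θ.map_mul, h2]) (fun y r => by simp [θ.map_mul, h1])
    (fun x y r => by simp [θ.map_mul, ← mul_assoc, h3])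
  refine ⟨θ.toLinearEquiv a, fun y r => ?_⟩
  obtain ⟨r, rfl⟩ := θ.toLinearEquiv.surjective r
  obtain ⟨y, rfl⟩ := θ.toLinearEquiv.surjective y
  simpa [← θ.map_mul, θ.symm_apply_apply, mul_assoc] using ha r y

end Duality

instance {R : Type u} [Ring R] (e : R) : Module.Finite R (leftIdeal R e) :=
  Module.Finite.of_surjective ((LinearMap.toSpanSingleton R R e).codRestrict _ fun x => ⟨x, rfl⟩)
    (by rintro ⟨_, a, rfl⟩; exact ⟨a, rfl⟩)

/-! ### The map `D(R) → R` and the passage to infinite dominant dimension -/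

namespace FaithfulSymmetricCorner

variable {K : Type u} [Field K] {R S : Type u} [Ring R] [Algebra K R] [Ring S] [Algebra K S]
  {e : R} {l : R →ₗ[K] K} (θ : AntiIso K R S)

theorem eq_of_forall (h : FaithfulSymmetricCorner K R e l) {a b : R}
    (hab : ∀ y r, l (y * a * r) = l (y * b * r)) : a = b := by
  rw [← sub_eq_zero]
  refine h.faithful_left _ fun y => ?_
  rw [mul_assoc]
  refine h.nondeg_right _ fun r => ?_
  rw [mul_sub, sub_mul, map_sub, hab, sub_self]

/-- The canonical map from the injective cogenerator to the regular module. -/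
theorem exists_cogenerator_map (h : FaithfulSymmetricCorner K R e l)
    (hD : DoubleCentralizer e l) :
    ∃ ε : DualMod θ.symm S →ₗ[R] R, ∀ f y r,
      f.toDual (θ.toLinearEquiv (r * e * y)) = l (y * ε f * r) := by
  have ex : ∀ f : DualMod θ.symm S, ∃ a, ∀ y r,
      f.toDual (θ.toLinearEquiv (r * e * y)) = l (y * a * r) := fun f => by
    refine hD (LinearMap.mk₂ K (fun y r => f.toDual (θ.toLinearEquiv (r * e * y)))
      ?_ ?_ ?_ ?_) ?_ ?_ ?_
    · intro y y' r; simp [mul_add]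
    · intro c y r; simp
    · intro y r r'; simp [add_mul]
    · intro c y r; simp
    · intro y r; simp [mul_assoc, h.e_mul_e_mul]
    · intro y r; simp [mul_assoc, h.e_mul_e_mul]
    · intro x y r; simp [mul_assoc]
  choose F hF using ex
  refine ⟨⟨⟨F, fun f g => h.eq_of_forall fun y r => ?_⟩, fun s f => h.eq_of_forall fun y r => ?_⟩,
    hF⟩
  · rw [← hF, mul_add, add_mul, map_add, ← hF, ← hF]
    rfl
  · rw [← hF, RingHom.id_apply, smul_eq_mul, ← mul_assoc, ← hF, ← mul_assoc, θ.map_mul _ s]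
    rfl

/-- `D(S)` is generated by `e D(S)`: an element of `S` on which all of `R e D(S)` vanishes is zero
by faithfulness. -/
theorem linearMap_eq_zero (h : FaithfulSymmetricCorner K R e l) [FiniteDimensional K S]
    {C : Type u} [AddCommGroup C] [Module R C] (k : DualMod θ.symm S →ₗ[R] C)
    (hk : ∀ f, k (e • f) = 0) : k = 0 := by
  let W : Submodule K (Module.Dual K S) :=
    ((LinearMap.ker k).restrictScalars K : Submodule K (DualMod θ.symm S))
  have hW : W.dualCoannihilator = ⊥ := by
    refine (Submodule.eq_bot_iff _).2 fun s hs => (h.dual θ).faithful_left s fun b => ?_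
    refine (Module.forall_dual_apply_eq_zero_iff K _).1 fun φ => ?_
    let f : DualMod θ.symm S := φ
    have hf : θ.symm.toLinearEquiv b • e • f ∈ LinearMap.ker k := by
      rw [LinearMap.mem_ker, map_smul, hk, smul_zero]
    have := (Submodule.mem_dualCoannihilator _).1 hs _ hf
    change f.toDual (θ.toLinearEquiv e • θ.toLinearEquiv (θ.symm.toLinearEquiv b) • s) = 0 at this
    rwa [θ.apply_symm_apply, smul_smul] at this
  have hW' : W = ⊤ := by
    rw [← Subspace.dualCoannihilator_dualAnnihilator_eq (W := W), hW]
    simp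
  refine LinearMap.ext fun f => ?_
  exact hW'.ge (Submodule.mem_top (x := f.toDual))

/-- A single module `T` killed by `e` suffices to test the next degree, provided that `Hom(T, C) =
0` already forces `C` to be torsion-free; dimension shifting reduces to that case. -/
theorem dom_succ_of_detecting (h : FaithfulSymmetricCorner K R e l) [FiniteDimensional K R]
    {T : Type u} [AddCommGroup T] [Module R T] (heT : ∀ t : T, e • t = 0)
    (hT : ∀ C : ModuleCat.{u} R, (∀ f : T →ₗ[R] C, f = 0) → TorsionFree e C) (n : ℕ) :
    ∀ (N : Type u) [AddCommGroup N] [Module R N] [Module.Finite R N], Dom e n N →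
      ExtZ R T N n → Dom e (n + 1) N := by
  induction n with
  | zero =>
    intro N _ _ _ _ hN
    exact dom_one_iff.2 (hT (ModuleCat.of R N) (extZ_zero_iff.1 hN))
  | succ n ih =>
    intro N _ _ _ hN hx
    obtain ⟨m, f, hf, hC⟩ := h.exists_cosyzygy hN
    refine (h.dom_pi_leftIdeal m (n + 2)).of_cosyzygy hf (exact_mkQ_range f)
      (Submodule.mkQ_surjective _) (ih _ hC ?_)
    exact extZ_cov_right hf (exact_mkQ_range f) (Submodule.mkQ_surjective _)
      (h.dom_pi_leftIdeal m (n + 1) (ModuleCat.of R T) heT n n.lt_succ_self) hx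

/-- The kernel of `ε` is killed by `e`, so `Ext^k(ker ε, N) = 0`. Together with `hx` this gives
`Ext^(k+1)(im ε, N) = 0`, hence `Ext^(k+2)(R / im ε, N) = 0`, and `R / im ε` is a detecting module.
-/
theorem dom_add_three (h : FaithfulSymmetricCorner K R e l) [FiniteDimensional K R]
    [FiniteDimensional K S] (hD : DoubleCentralizer e l) {N : Type u} [AddCommGroup N]
    [Module R N] [Module.Finite R N] {k : ℕ} (hN : Dom e (k + 2) N)
    (hx : ExtZ R (DualMod θ.symm S) N (k + 1)) : Dom e (k + 3) N := by
  obtain ⟨ε, hε⟩ := h.exists_cogenerator_map θ hD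
  have h1 : ExtZ R (LinearMap.ker ε) N k := by
    refine hN (ModuleCat.of R (LinearMap.ker ε)) ?_ k (by omega)
    rintro ⟨f, hf⟩
    refine Subtype.ext (DualMod.ext fun s => ?_)
    obtain ⟨r, rfl⟩ := θ.toLinearEquiv.surjective s
    have := hε f 1 r
    rw [LinearMap.mem_ker.1 hf, mul_zero, zero_mul, map_zero, mul_one, θ.map_mul] at this
    exact this
  have h2 : ExtZ R (LinearMap.range ε) N (k + 1) :=
    extZ_contra_right (f := (LinearMap.ker ε).subtype) (g := ε.rangeRestrict)
      (Submodule.subtype_injective _) (fun x => by simp [Subtype.ext_iff]) ε.surjective_rangeRestrict h1 hx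
  have h3 : ExtZ R (R ⧸ LinearMap.range ε) N (k + 2) :=
    extZ_contra_right (f := (LinearMap.range ε).subtype) (g := (LinearMap.range ε).mkQ)
      (Submodule.subtype_injective _) (LinearMap.exact_subtype_mkQ _) (Submodule.mkQ_surjective _)
      h2 (extZ_of_projective (k + 1))
  -- The form `l (e * b * ·)` is a preimage of `e * b`; hence `e` kills the cokernel of `ε`.
  have h4 : ∀ b, e * b ∈ LinearMap.range ε := fun b => by
    let f : DualMod θ.symm S := l ∘ₗ LinearMap.mulLeft K (e * b) ∘ₗ θ.symm.toLinearEquiv.toLinearMap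
    refine ⟨f, h.eq_of_forall fun y r => ?_⟩
    rw [← hε]
    change l (e * b * θ.symm.toLinearEquiv (θ.toLinearEquiv (r * e * y))) = _
    rw [θ.symm_apply_apply, mul_assoc e, h.map_e_mul, ← mul_assoc, ← mul_assoc, h.symm]
    simp only [mul_assoc]
  refine h.dom_succ_of_detecting (fun t => ?_) (fun C hC x hx => ?_) (k + 2) N hN h3
  · obtain ⟨b, rfl⟩ := Submodule.mkQ_surjective _ t
    rw [← map_smul]
    exact (Submodule.Quotient.mk_eq_zero _).2 (h4 b)
  -- If `eRx = 0`, then `1 ↦ x` vanishes on `im ε` and factors through `R / im ε`.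
  have h5 : LinearMap.toSpanSingleton R C x ∘ₗ ε = 0 :=
    h.linearMap_eq_zero θ _ fun f => by simpa [smul_smul] using hx (ε f)
  have h6 := LinearMap.congr_fun (hC ((LinearMap.range ε).liftQ
    (LinearMap.toSpanSingleton R C x) (LinearMap.range_le_ker_iff.2 h5)))
    ((LinearMap.range ε).mkQ 1)
  simpa using h6

theorem dom_of_extZ (h : FaithfulSymmetricCorner K R e l) [FiniteDimensional K R]
    [FiniteDimensional K S] (hR : Dom e 2 R) {N : Type u} [AddCommGroup N]
    [Module R N] [Module.Finite R N] (hN : Dom e 2 N)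
    (hx : ∀ i, ExtZ R (DualMod θ.symm S) N (i + 1)) (n : ℕ) : Dom e n N := by
  suffices H : ∀ k, Dom e (k + 2) N from (H n).mono (by omega)
  intro k
  induction k with
  | zero => exact hN
  | succ k ih => exact h.dom_add_three θ (h.doubleCentralizer_of_dom hR) ih (hx k)

/-- `N` is a `k`-th syzygy with projective middle terms, so its Ext groups against `R` move up `k`
degrees, beyond the injective dimension. -/
theorem extZ_self_of_dom (h : FaithfulSymmetricCorner K R e l) [FiniteDimensional K R] {g : ℕ}
    (hg : ∀ (X : ModuleCat.{u} R) (n), g < n → ExtZ R X R n) (k : ℕ) : ∀ (N : Type u)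
    [AddCommGroup N] [Module R N] [Module.Finite R N], Dom e k N → ∀ j, g < j + 1 + k →
      ExtZ R N R (j + 1) := by
  induction k with
  | zero => exact fun N _ _ _ _ j hj => hg (ModuleCat.of R N) _ hj
  | succ k ih =>
    intro N _ _ _ hN j hj
    obtain ⟨m, f, hf, hC⟩ := h.exists_cosyzygy hN
    have := h.projective_pi_leftIdeal m
    exact extZ_contra_left hf (exact_mkQ_range f) (Submodule.mkQ_surjective _)
      (extZ_of_projective j) (ih _ hC (j + 1) (by omega))

/-- A cosyzygy step lowers the bound for `M` by one and raises that for `D(M)` by one, so `k` steps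
reach the balanced case. There each side supplies the Ext-vanishing that makes the other infinite.
-/
theorem dom_and_dom_dual (h : FaithfulSymmetricCorner K R e l) [FiniteDimensional K R]
    [FiniteDimensional K S] (hR : Dom e 2 R) (hS : Dom (θ.toLinearEquiv e) 2 S) {g : ℕ}
    (hgR : ∀ (X : ModuleCat.{u} R) (n), g < n → ExtZ R X R n)
    (hgS : ∀ (X : ModuleCat.{u} S) (n), g < n → ExtZ S X S n) (hg : 2 ≤ g) (k : ℕ) :
    ∀ (b : ℕ) (M : Type u) [AddCommGroup M] [Module K M] [Module R M] [IsScalarTower K R M]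
      [FiniteDimensional K M], Dom e (g + k) M → Dom (θ.toLinearEquiv e) b (DualMod θ M) →
      g ≤ b + k → ∀ n, Dom e n M ∧ Dom (θ.toLinearEquiv e) n (DualMod θ M) := by
  induction k with
  | zero =>
    intro b M _ _ _ _ _ hM hDM hb n
    have : Module.Finite R M := Module.Finite.of_restrictScalars_finite K R M
    have : Module.Finite S (DualMod θ M) := Module.Finite.of_restrictScalars_finite K S _
    have hM' := h.extZ_self_of_dom hgR g M hM
    have hDM' := (h.dual θ).extZ_self_of_dom hgS g (DualMod θ M) (hDM.mono hb)
    constructor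
    · refine h.dom_of_extZ θ hR (hM.mono hg) (fun i => ?_) n
      exact extZ_congr (LinearEquiv.refl _ _) (DualMod.evalEquiv θ M).symm
        (DualMod.extZ_dual θ.symm i _ (hDM' i (by omega)))
    · exact (h.dual θ).dom_of_extZ θ.symm hS (hDM.mono (hg.trans hb))
        (fun i => DualMod.extZ_dual θ i _ (hM' i (by omega))) n
  | succ k ih =>
    intro b M _ _ _ _ _ hM hDM hb n
    have : Module.Finite R M := Module.Finite.of_restrictScalars_finite K R M
    obtain ⟨m, f, hf, hC⟩ := h.exists_cosyzygy (n := g + k) hM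
    have hex := exact_mkQ_range f
    have hs := Submodule.mkQ_surjective (LinearMap.range f)
    -- Dualising the sequence makes `D(M)` a cosyzygy of `D(C)`.
    have hDC := (h.dom_dualMod θ m (b + 1)).of_cosyzygy (DualMod.map_injective θ hs)
      (DualMod.map_exact θ hex hs) (DualMod.map_surjective θ hf) hDM
    have H := ih (b + 1) _ hC hDC (by omega)
    exact ⟨((h.dom_pi_leftIdeal m (n + 1)).of_cosyzygy hf hex hs (H n).1).mono n.le_succ,
      (h.dom_dualMod θ m n).cosyzygy (DualMod.map_injective θ hs)
      (DualMod.map_exact θ hex hs) (DualMod.map_surjective θ hf) (H (n + 1)).2⟩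

end FaithfulSymmetricCorner

/-! ### Injective hulls, projective covers and minimal resolutions -/

section Minimal

variable {R : Type u} [Ring R] {F : Type u} [AddCommGroup F] [Module R F]

/-- Among the endomorphisms in a submonoid there is one with minimal range. -/
theorem exists_minimal_range [IsArtinian R F] {p : Module.End R F → Prop} (h1 : p 1) :
    ∃ f, p f ∧ ∀ g, p g → LinearMap.range g ≤ LinearMap.range f →
      LinearMap.range g = LinearMap.range f := by
  obtain ⟨L, ⟨f, hf, rfl⟩, hL⟩ := IsArtinian.set_has_minimal
    {L : Submodule R F | ∃ f, p f ∧ LinearMap.range f = L} ⟨_, 1, h1, rfl⟩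
  refine ⟨f, hf, fun g hg hgf => ?_⟩
  by_contra hne
  exact hL _ ⟨g, hg, rfl⟩ (lt_of_le_of_ne hgf hne)

/-- By minimality `f * h * f` has the same range as `f`, so `f * h` maps that range onto itself; a
surjective endomorphism of a Noetherian module is injective. -/
theorem eq_zero_of_minimal_range [IsNoetherian R F] {p : Module.End R F → Prop}
    (hmul : ∀ f g, p f → p g → p (f * g)) {f : Module.End R F} (hf : p f)
    (hmin : ∀ g, p g → LinearMap.range g ≤ LinearMap.range f →
      LinearMap.range g = LinearMap.range f) {h : Module.End R F} (hh : p h) {x : F}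
    (hx : x ∈ LinearMap.range f) (hfx : f (h x) = 0) : x = 0 := by
  have hr : LinearMap.range (f * h * f) = LinearMap.range f :=
    hmin _ (hmul _ _ (hmul _ _ hf hh) hf) (by
      rintro _ ⟨y, rfl⟩
      exact ⟨h (f y), rfl⟩)
  let E : LinearMap.range f →ₗ[R] LinearMap.range f := (f.rangeRestrict ∘ₗ h).domRestrict _
  have hE : Function.Injective E := by
    refine IsNoetherian.injective_of_surjective_endomorphism E ?_
    rintro ⟨y, hy⟩
    rw [← hr] at hy
    obtain ⟨z, rfl⟩ := hy
    exact ⟨⟨f z, z, rfl⟩, rfl⟩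
  have : (⟨x, hx⟩ : LinearMap.range f) = 0 := hE <| by
    rw [map_zero]
    exact Subtype.ext hfx
  exact congrArg Subtype.val this

theorem exists_retraction_of_minimal_range [IsNoetherian R F] [IsArtinian R F]
    {p : Module.End R F → Prop} (h1 : p 1)
    (hmul : ∀ f g, p f → p g → p (f * g)) {f : Module.End R F} (hf : p f)
    (hmin : ∀ g, p g → LinearMap.range g ≤ LinearMap.range f →
      LinearMap.range g = LinearMap.range f) :
    ∃ r : F →ₗ[R] LinearMap.range f, r ∘ₗ (LinearMap.range f).subtype = LinearMap.id := by
  let E : LinearMap.range f →ₗ[R] LinearMap.range f := f.rangeRestrict.domRestrict _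
  have hE : Function.Injective E := (injective_iff_map_eq_zero E).2 fun x hx =>
    Subtype.ext (eq_zero_of_minimal_range hmul hf hmin h1 x.2 (congrArg Subtype.val hx))
  let E' := LinearEquiv.ofBijective E ⟨hE, IsArtinian.surjective_of_injective_endomorphism E hE⟩
  exact ⟨E'.symm.toLinearMap ∘ₗ f.rangeRestrict, LinearMap.ext fun x => E'.symm_apply_apply x⟩

theorem injective_of_retract {I : Type u} [AddCommGroup I] [Module R I] (hF : Module.Injective R F)
    (i : I →ₗ[R] F) (r : F →ₗ[R] I) (h : r ∘ₗ i = LinearMap.id) : Module.Injective R I := by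
  refine ⟨fun X Y _ _ _ _ f hf g => ?_⟩
  obtain ⟨k, hk⟩ := hF.out f hf (i ∘ₗ g)
  exact ⟨r ∘ₗ k, fun x => by simpa [hk] using LinearMap.congr_fun h (g x)⟩

end Minimal

section Hulls

/-- The canonical anti-isomorphism to the opposite algebra. -/
def AntiIso.op (K : Type u) [Field K] (R : Type u) [Ring R] [Algebra K R] : AntiIso K R Rᵐᵒᵖ where
  toLinearEquiv := MulOpposite.opLinearEquiv K
  map_mul' _ _ := rfl

theorem exists_finite_injective_embedding (K : Type u) [Field K] {R : Type u} [Ring R]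
    [Algebra K R] [FiniteDimensional K R]
    (M : Type u) [AddCommGroup M] [Module R M]
    [Module.Finite R M] : ∃ (F : ModuleCat.{u} R) (f : M →ₗ[R] F), Module.Finite R F ∧
      Module.Injective R F ∧ Function.Injective f := by
  let _ : Module K M := Module.compHom M (algebraMap K R)
  have : IsScalarTower K R M := IsScalarTower.of_algebraMap_smul fun _ _ => rfl
  have : Module.Finite K M := Module.Finite.trans R M
  let θ := AntiIso.op K R
  have : Module.Finite Rᵐᵒᵖ (DualMod θ M) := Module.Finite.of_restrictScalars_finite K _ _
  obtain ⟨n, q, hq⟩ := Module.Finite.exists_fin' Rᵐᵒᵖ (DualMod θ M)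
  have : FiniteDimensional K Rᵐᵒᵖ := Module.Finite.equiv (MulOpposite.opLinearEquiv K)
  refine ⟨ModuleCat.of R (DualMod θ.symm (Fin n → Rᵐᵒᵖ)),
    DualMod.map θ.symm q ∘ₗ (DualMod.evalEquiv θ M).toLinearMap,
    Module.Finite.of_restrictScalars_finite K R (DualMod θ.symm (Fin n → Rᵐᵒᵖ)),
    DualMod.injective_of_projective θ.symm,
    (DualMod.map_injective θ.symm hq).comp (DualMod.evalEquiv θ M).injective⟩

theorem isNoetherianRing_of_finiteDimensional (K : Type u) [Field K] {R : Type u} [Ring R]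
    [Algebra K R] [FiniteDimensional K R] : IsNoetherianRing R :=
  isNoetherian_of_isNoetherianRing_of_finite K R |> isNoetherian_of_tower K

theorem isArtinianRing_of_finiteDimensional (K : Type u) [Field K] {R : Type u} [Ring R]
    [Algebra K R] [FiniteDimensional K R] : IsArtinianRing R :=
  isArtinian_of_tower K (inferInstanceAs (IsArtinian K R))

/-- Injective hulls of finitely generated modules over a finite-dimensional algebra. -/
theorem exists_injective_hull (K : Type u) [Field K] {R : Type u} [Ring R]
    [Algebra K R] [FiniteDimensional K R]
    (M : Type u) [AddCommGroup M] [Module R M]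
    [Module.Finite R M] : ∃ (I : ModuleCat.{u} R) (ι : M →ₗ[R] I), Module.Finite R I ∧
      Module.Injective R I ∧ Function.Injective ι ∧ IsEssential (LinearMap.range ι) := by
  have := isNoetherianRing_of_finiteDimensional K (R := R)
  have := isArtinianRing_of_finiteDimensional K (R := R)
  obtain ⟨F, j, hfin, hF, hj⟩ := exists_finite_injective_embedding K M (R := R)
  have h1 : (1 : Module.End R F) ∘ₗ j = j := rfl
  have hmul : ∀ f g : Module.End R F, f ∘ₗ j = j → g ∘ₗ j = j → (f * g) ∘ₗ j = j :=
    fun f g hf hg => by rw [Module.End.mul_eq_comp, LinearMap.comp_assoc, hg, hf]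
  obtain ⟨f, hf, hmin⟩ := exists_minimal_range (p := fun f : Module.End R F => f ∘ₗ j = j) h1
  obtain ⟨r, hr⟩ := exists_retraction_of_minimal_range h1 hmul hf hmin
  have hfj : ∀ x, f (j x) = j x := LinearMap.congr_fun hf
  refine ⟨ModuleCat.of R (LinearMap.range f), j.codRestrict _ fun x => ⟨j x, hfj x⟩,
    inferInstanceAs (Module.Finite R (LinearMap.range f)), injective_of_retract hF _ r hr,
    fun x y hxy => hj (congrArg Subtype.val hxy), fun L hL => ?_⟩
  -- `M` still embeds into `F / L'`, so its embedding into `F` extends over the quotient. This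
  -- yields an endomorphism of `F` that fixes `M` and kills `L`, whence `L = 0` by minimality of the
  -- range.
  let L' : Submodule R F := L.map (LinearMap.range f).subtype
  have hinj : Function.Injective (L'.mkQ ∘ₗ j) := (injective_iff_map_eq_zero _).2 fun x hx => by
    obtain ⟨y, hy, hyx⟩ : j x ∈ L' := (Submodule.Quotient.mk_eq_zero _).1 hx
    have : y ∈ LinearMap.range (j.codRestrict (LinearMap.range f) fun x => ⟨j x, hfj x⟩) ⊓ L :=
      ⟨⟨x, Subtype.ext hyx.symm⟩, hy⟩
    rw [hL, Submodule.mem_bot] at this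
    apply hj
    rw [map_zero, ← hyx, this, map_zero]
  obtain ⟨h, hh⟩ := hF.out _ hinj j
  refine (Submodule.eq_bot_iff _).2 fun x hx => Subtype.ext ?_
  refine eq_zero_of_minimal_range hmul hf hmin (h := h ∘ₗ L'.mkQ) (LinearMap.ext hh) x.2 ?_
  have : L'.mkQ x = 0 := (Submodule.Quotient.mk_eq_zero _).2 ⟨x, hx, rfl⟩
  rw [LinearMap.comp_apply, this, map_zero, map_zero]

/-- Projective covers of finitely generated modules over a finite-dimensional algebra. -/
theorem exists_projective_cover (K : Type u) [Field K] {R : Type u} [Ring R]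
    [Algebra K R] [FiniteDimensional K R]
    (M : Type u) [AddCommGroup M] [Module R M]
    [Module.Finite R M] : ∃ (P : ModuleCat.{u} R) (π : P →ₗ[R] M), Module.Finite R P ∧
      Module.Projective R P ∧ Function.Surjective π ∧ IsSuperfluous (LinearMap.ker π) := by
  have := isNoetherianRing_of_finiteDimensional K (R := R)
  have := isArtinianRing_of_finiteDimensional K (R := R)
  obtain ⟨n, q, hq⟩ := Module.Finite.exists_fin' R M
  have h1 : q ∘ₗ (1 : Module.End R (Fin n → R)) = q := rfl
  have hmul : ∀ f g : Module.End R (Fin n → R), q ∘ₗ f = q → q ∘ₗ g = q → q ∘ₗ (f * g) = q :=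
    fun f g hf hg => by rw [Module.End.mul_eq_comp, ← LinearMap.comp_assoc, hf, hg]
  obtain ⟨f, hf, hmin⟩ :=
    exists_minimal_range (p := fun f : Module.End R (Fin n → R) => q ∘ₗ f = q) h1
  obtain ⟨r, hr⟩ := exists_retraction_of_minimal_range h1 hmul hf hmin
  refine ⟨ModuleCat.of R (LinearMap.range f), q ∘ₗ (LinearMap.range f).subtype,
    inferInstanceAs (Module.Finite R (LinearMap.range f)), Module.Projective.of_split _ r hr,
    fun y => ?_, fun L hL => ?_⟩
  · obtain ⟨x, rfl⟩ := hq y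
    exact ⟨⟨f x, x, rfl⟩, LinearMap.congr_fun hf x⟩
  · have hs : Function.Surjective (q ∘ₗ (LinearMap.range f).subtype ∘ₗ L.subtype) := fun y => by
      obtain ⟨x, rfl⟩ := hq y
      obtain ⟨a, ha, b, hb, hab⟩ := Submodule.mem_sup.1
        (hL.ge (Submodule.mem_top (x := (⟨f x, x, rfl⟩ : LinearMap.range f))))
      refine ⟨⟨b, hb⟩, ?_⟩
      have h2 : q (a : Fin n → R) = 0 := ha
      have h3 : (a : Fin n → R) + b = f x := congrArg Subtype.val hab
      change q b = q x
      rw [← LinearMap.congr_fun hf x, LinearMap.comp_apply, ← h3, map_add, h2, zero_add]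
    obtain ⟨h, hh⟩ := Module.projective_lifting_property _ q hs
    have := hmin ((LinearMap.range f).subtype ∘ₗ L.subtype ∘ₗ h) hh (by
      rintro _ ⟨x, rfl⟩
      exact (h x).1.2)
    refine eq_top_iff.2 fun x _ => ?_
    obtain ⟨y, hy⟩ := this.ge x.2
    have : (h y).1 = x := Subtype.ext hy
    exact this ▸ (h y).2

theorem exists_minProjPresentation (K : Type u) [Field K] {R : Type u} [Ring R]
    [Algebra K R] [FiniteDimensional K R]
    (M : Type u) [AddCommGroup M] [Module R M]
    [Module.Finite R M] : Nonempty (MinProjPresentation R M) := by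
  have := isNoetherianRing_of_finiteDimensional K (R := R)
  obtain ⟨P₀, π, hfin₀, hp₀, hπ, hs₀⟩ := exists_projective_cover K M (R := R)
  obtain ⟨P₁, ρ, hfin₁, hp₁, hρ, hs₁⟩ := exists_projective_cover K (LinearMap.ker π) (R := R)
  refine ⟨⟨P₀, P₁, hfin₀, hfin₁, hp₀, hp₁, π, (LinearMap.ker π).subtype ∘ₗ ρ, hπ, fun x => ?_,
    hs₀, ?_⟩⟩
  · constructor
    · intro hx
      obtain ⟨y, hy⟩ := hρ ⟨x, hx⟩
      exact ⟨y, congrArg Subtype.val hy⟩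
    · rintro ⟨y, rfl⟩
      exact (ρ y).2
  · rwa [LinearMap.ker_comp_of_ker_eq_bot _ (Submodule.ker_subtype _)]

theorem exists_minInjResolution (K : Type u) [Field K] {R : Type u} [Ring R]
    [Algebra K R] [FiniteDimensional K R]
    (M : Type u) [AddCommGroup M] [Module R M]
    [Module.Finite R M] : ∃ E : MinInjResolution R M, ∀ n, Module.Finite R (E.I n) := by
  have H : ∀ N : {N : ModuleCat.{u} R // Module.Finite R N}, ∃ (I : ModuleCat.{u} R)
      (ι : N.1 →ₗ[R] I), Module.Finite R I ∧ Module.Injective R I ∧ Function.Injective ι ∧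
        IsEssential (LinearMap.range ι) := fun N =>
    have := N.2
    exists_injective_hull K N.1
  choose I ι hfin hinj hι hess using H
  let C : ℕ → {N : ModuleCat.{u} R // Module.Finite R N} := fun n => Nat.rec
    ⟨ModuleCat.of R M, inferInstanceAs (Module.Finite R M)⟩
    (fun _ N => ⟨ModuleCat.of R (I N ⧸ LinearMap.range (ι N)),
      have := hfin N
      inferInstanceAs (Module.Finite R (I N ⧸ LinearMap.range (ι N)))⟩) n
  have hex : ∀ n, Function.Exact (ι (C n))
      (ι (C (n + 1)) ∘ₗ (LinearMap.range (ι (C n))).mkQ) := fun n => by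
    refine LinearMap.exact_iff.2 ?_
    rw [LinearMap.ker_comp_of_ker_eq_bot _ (LinearMap.ker_eq_bot.2 (hι (C (n + 1))))]
    exact Submodule.ker_mkQ _
  have hrange : ∀ n, LinearMap.range (ι (C (n + 1)) ∘ₗ (LinearMap.range (ι (C n))).mkQ) =
      LinearMap.range (ι (C (n + 1))) := fun n =>
    LinearMap.range_comp_of_range_eq_top _ (Submodule.range_mkQ _)
  refine ⟨⟨fun n => I (C n), fun n => hinj _, ι (C 0),
    fun n => ι (C (n + 1)) ∘ₗ (LinearMap.range (ι (C n))).mkQ, hι _, hex 0, fun n => ?_,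
    hess _, fun n => ?_⟩, fun n => hfin _⟩
  · refine LinearMap.exact_iff.2 ?_
    rw [hrange]
    exact LinearMap.exact_iff.1 (hex (n + 1))
  · rw [hrange]
    exact hess _

end Hulls

/-- The minimal injective resolution of the first cosyzygy. -/
def MinInjResolution.tail {R : Type u} [Ring R] {M : Type u} [AddCommGroup M] [Module R M]
    (E : MinInjResolution R M) : MinInjResolution R (E.I 0 ⧸ LinearMap.range E.ι) where
  I n := E.I (n + 1)
  injective n := E.injective (n + 1)
  ι := (LinearMap.range E.ι).liftQ (E.d 0) (LinearMap.exact_iff.1 E.exact_zero).ge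
  d n := E.d (n + 1)
  ι_injective := LinearMap.ker_eq_bot.1
    (Submodule.ker_liftQ_eq_bot _ _ _ (LinearMap.exact_iff.1 E.exact_zero).le)
  exact_zero := by
    rw [LinearMap.exact_iff, Submodule.range_liftQ]
    exact LinearMap.exact_iff.1 (E.exact_succ 0)
  exact_succ n := E.exact_succ (n + 1)
  essential_zero := by
    rw [Submodule.range_liftQ]
    exact E.essential_succ 0
  essential_succ n := E.essential_succ (n + 1)

theorem TorsionFree.of_isEssential {R : Type u} [Ring R] {e : R} {M I : Type u} [AddCommGroup M]
    [Module R M] [AddCommGroup I] [Module R I] (h : TorsionFree e M) {ι : M →ₗ[R] I}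
    (hinj : Function.Injective ι) (hess : IsEssential (LinearMap.range ι)) : TorsionFree e I := by
  intro x hx
  have hL : ∀ y ∈ Submodule.span R {x}, ∀ r : R, (e * r) • y = 0 := by
    intro y hy r
    obtain ⟨s, rfl⟩ := Submodule.mem_span_singleton.1 hy
    rw [smul_smul, mul_assoc]
    exact hx _
  have := hess (Submodule.span R {x}) ((Submodule.eq_bot_iff _).2 ?_)
  · exact Submodule.span_singleton_eq_bot.1 this
  · rintro _ ⟨⟨m, rfl⟩, hm⟩
    rw [h m fun r => hinj (by rw [map_smul, hL _ hm, map_zero]), map_zero]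

/-! ### Dominant dimension as Ext-vanishing -/

namespace FaithfulSymmetricCorner

variable {K : Type u} [Field K] {R : Type u} [Ring R] [Algebra K R] {e : R} {l : R →ₗ[K] K}

theorem dom_of_minInjResolution (h : FaithfulSymmetricCorner K R e l) (n : ℕ) : ∀ (M : Type u)
    [AddCommGroup M] [Module R M] (E : MinInjResolution R M),
    (∀ i < n, Module.Projective R (E.I i)) → Dom e n M := by
  induction n with
  | zero => exact fun M _ _ _ _ X _ i hi => absurd hi (by omega)
  | succ n ih =>
    intro M _ _ E hE
    have := hE 0 (by omega)
    exact (h.torsionFree_of_projective.dom_of_injective (E.injective 0) _).of_cosyzygy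
      E.ι_injective (exact_mkQ_range _) (Submodule.mkQ_surjective _)
      (ih _ E.tail fun i hi => hE (i + 1) (by omega))

theorem torsionFree_minInjResolution (n : ℕ) : ∀ (M : Type u)
    [AddCommGroup M] [Module R M] (E : MinInjResolution R M), Dom e n M →
    ∀ i < n, TorsionFree e (E.I i) := by
  induction n with
  | zero => exact fun M _ _ _ _ i hi => absurd hi (by omega)
  | succ n ih =>
    intro M _ _ E hM i hi
    have h0 : TorsionFree e (E.I 0) := (dom_one_iff.1 (hM.mono (by omega))).of_isEssential
      E.ι_injective E.essential_zero
    rcases i with _ | i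
    · exact h0
    · exact ih _ E.tail ((h0.dom_of_injective (E.injective 0) n).cosyzygy E.ι_injective
        (exact_mkQ_range _) (Submodule.mkQ_surjective _) hM) i (by omega)

/-- Projective modules are torsion-free, which gives one direction. For the other, the terms of a
finitely generated minimal injective resolution inherit torsion-freeness by essentiality and are
then summands of powers of `Re`. -/
theorem le_domdim_iff (h : FaithfulSymmetricCorner K R e l) [FiniteDimensional K R] {M : Type u}
    [AddCommGroup M] [Module R M] [Module.Finite R M] (n : ℕ) :
    (n : ℕ∞) ≤ domdim R M ↔ Dom e n M := by
  constructor
  · intro hn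
    by_contra hD
    have hlt : domdim R M ≤ (n - 1 : ℕ) := by
      refine iSup₂_le fun m hm => ?_
      obtain ⟨E, hE⟩ := hm
      have hm := h.dom_of_minInjResolution m M E hE
      have : m < n := by
        by_contra hmn
        exact hD (hm.mono (by omega))
      exact_mod_cast (show m ≤ n - 1 by omega)
    have hn0 : n ≠ 0 := by
      rintro rfl
      exact hD fun X _ i hi => absurd hi (by omega)
    have := hn.trans hlt
    have : n ≤ n - 1 := by exact_mod_cast this
    omega
  · intro hD
    obtain ⟨E, hE⟩ := exists_minInjResolution K M (R := R)
    refine le_iSup₂_of_le n ⟨E, fun i hi => ?_⟩ le_rfl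
    have := hE i
    exact h.projective_of_injective (E.injective i) (torsionFree_minInjResolution n M E hD i hi)

end FaithfulSymmetricCorner

theorem exists_descend {R : Type u} [Ring R] {I N X : Type u} [AddCommGroup I] [Module R I]
    [AddCommGroup N] [Module R N] [AddCommGroup X] [Module R X] {g : I →ₗ[R] N}
    (hg : Function.Surjective g) (k : I →ₗ[R] X) (hk : LinearMap.ker g ≤ LinearMap.ker k) :
    ∃ l : N →ₗ[R] X, ∀ x, l (g x) = k x :=
  ⟨(LinearMap.ker g).liftQ k hk ∘ₗ (g.quotKerEquivOfSurjective hg).symm.toLinearMap, fun x => by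
    have : (g.quotKerEquivOfSurjective hg).symm (g x) = (LinearMap.ker g).mkQ x := by
      rw [LinearEquiv.symm_apply_eq]
      rfl
    simp [this]⟩

/-! ### Transposes, reflexivity and Gorenstein projectivity -/

section RegularBimodule

variable {R S U : Type u} [Ring R] [Ring S] [AddCommGroup U] [Module R U] [Module S U]
  [SMulCommClass R S U] {u₀ : U}

section Projective

variable {P : Type u} [AddCommGroup P] [Module R P] [Module.Finite R P] [Module.Projective R P]

variable (R P) in
theorem exists_retract_pi : ∃ (n : ℕ) (i : P →ₗ[R] (Fin n → R)) (q : (Fin n → R) →ₗ[R] P),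
    q ∘ₗ i = LinearMap.id := by
  obtain ⟨n, q, hq⟩ := Module.Finite.exists_fin' R P
  obtain ⟨i, hi⟩ := Module.projective_lifting_property q LinearMap.id hq
  exact ⟨n, i, q, hi⟩

theorem finite_projective_hom (hS : Function.Bijective fun s : S => s • u₀) :
    Module.Finite S (P →ₗ[R] U) ∧ Module.Projective S (P →ₗ[R] U) := by
  obtain ⟨n, i, q, hqi⟩ := exists_retract_pi R P
  let t : S ≃ₗ[S] U := LinearEquiv.ofBijective (LinearMap.toSpanSingleton S U u₀) hS
  let E : (Fin n → S) ≃ₗ[S] ((Fin n → R) →ₗ[R] U) :=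
    (LinearEquiv.piCongrRight fun _ => t).trans (LinearEquiv.piRing R U (Fin n) S).symm
  have hr : LinearMap.lcomp S U i ∘ₗ LinearMap.lcomp S U q = LinearMap.id := by
    refine LinearMap.ext fun φ => LinearMap.ext fun x => ?_
    exact congrArg φ (LinearMap.congr_fun hqi x)
  have h1 : Module.Finite S ((Fin n → R) →ₗ[R] U) := Module.Finite.equiv E
  have h2 : Module.Projective S ((Fin n → R) →ₗ[R] U) := Module.Projective.of_equiv E
  exact ⟨Module.Finite.of_surjective (LinearMap.lcomp S U i) fun φ =>
    ⟨LinearMap.lcomp S U q φ, LinearMap.congr_fun hr φ⟩, Module.Projective.of_split _ _ hr⟩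

theorem exists_eval_of_projective (hR : Function.Bijective fun r : R => r • u₀)
    (hS : Function.Bijective fun s : S => s • u₀) (ξ : (P →ₗ[R] U) →ₗ[S] U) :
    ∃ p, ∀ φ, ξ φ = φ p := by
  obtain ⟨n, i, q, hqi⟩ := exists_retract_pi R P
  let F : Fin n → ((Fin n → R) →ₗ[R] U) := fun k =>
    LinearMap.toSpanSingleton R U u₀ ∘ₗ LinearMap.proj k
  choose r hr using fun k => hR.2 (ξ (F k ∘ₗ i))
  refine ⟨q r, fun φ => ?_⟩
  choose s hs using fun k => hS.2 (φ (q (Pi.single k 1)))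
  have hφ : φ ∘ₗ q = ∑ k, s k • F k := by
    refine LinearMap.pi_ext' fun k => LinearMap.ext_ring ?_
    simp only [LinearMap.coe_comp, Function.comp_apply, LinearMap.coe_single, LinearMap.sum_apply,
      LinearMap.smul_apply, F, LinearMap.proj_apply, LinearMap.toSpanSingleton_apply]
    rw [Finset.sum_eq_single k]
    · simpa using (hs k).symm
    · intro j _ hjk
      simp [hjk]
    · simp
  have h1 : φ = (φ ∘ₗ q) ∘ₗ i := by rw [LinearMap.comp_assoc, hqi, LinearMap.comp_id]
  have h2 : ξ φ = ∑ k, s k • ξ (F k ∘ₗ i) := by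
    have h3 : ξ φ = (ξ ∘ₗ LinearMap.lcomp S U i) (φ ∘ₗ q) := congrArg ξ h1
    rw [h3, hφ, map_sum]
    exact Finset.sum_congr rfl fun k _ => map_smul _ _ _
  rw [h2, ← LinearMap.comp_apply, hφ, LinearMap.sum_apply]
  exact Finset.sum_congr rfl fun k _ => by rw [← hr]; rfl

theorem eq_zero_of_eval (hR : Function.Bijective fun r : R => r • u₀) {p : P}
    (hp : ∀ φ : P →ₗ[R] U, φ p = 0) : p = 0 := by
  obtain ⟨n, i, q, hqi⟩ := exists_retract_pi R P
  have : i p = 0 := funext fun k => hR.1 <| by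
    simpa using hp (LinearMap.toSpanSingleton R U u₀ ∘ₗ LinearMap.proj k ∘ₗ i)
  rw [← LinearMap.id_apply (R := R) p, ← hqi, LinearMap.comp_apply, this, map_zero]

end Projective

section Transpose

variable {M : Type u} [AddCommGroup M] [Module R M]

theorem lcomp_exact {M I N : Type u} [AddCommGroup M] [Module R M] [AddCommGroup I] [Module R I]
    [AddCommGroup N] [Module R N] {f : M →ₗ[R] I} {g : I →ₗ[R] N} (hfg : Function.Exact f g)
    (hg : Function.Surjective g) :
    Function.Exact (LinearMap.lcomp S U g) (LinearMap.lcomp S U f) := fun φ => by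
  constructor
  · intro h
    obtain ⟨l, hl⟩ := exists_descend hg φ fun x hx => by
      obtain ⟨y, rfl⟩ := (hfg x).1 hx
      exact LinearMap.congr_fun h y
    exact ⟨l, LinearMap.ext hl⟩
  · rintro ⟨ψ, rfl⟩
    refine LinearMap.ext fun x => ?_
    change ψ (g (f x)) = 0
    rw [hfg.apply_apply_eq_zero, map_zero]

theorem lcomp_injective {I N : Type u} [AddCommGroup I] [Module R I]
    [AddCommGroup N] [Module R N] {g : I →ₗ[R] N} (hg : Function.Surjective g) :
    Function.Injective (LinearMap.lcomp S U g) := fun φ ψ h => LinearMap.ext fun y => by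
  obtain ⟨x, rfl⟩ := hg y
  exact LinearMap.congr_fun h x

/-- If `U` has finite injective dimension over `S`, then `Ext_R^{≥1}(X, U) = 0` implies
`Ext_S^{≥1}(Hom_R(X, U), U) = 0`. -/
theorem extZ_hom_of_extZ [IsNoetherianRing R] (hS : Function.Bijective fun s : S => s • u₀) {g : ℕ}
    (hg : ∀ (X : ModuleCat.{u} S) (n), g < n → ExtZ S X U n) (k : ℕ) : ∀ (X : Type u)
    [AddCommGroup X] [Module R X] [Module.Finite R X], (∀ i, ExtZ R X U (i + 1)) →
      ∀ j, g < j + 1 + k → ExtZ S (X →ₗ[R] U) U (j + 1) := by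
  induction k with
  | zero => exact fun X _ _ _ _ j hj => hg (ModuleCat.of S (X →ₗ[R] U)) _ hj
  | succ k ih =>
    intro X _ _ _ hX j hj
    obtain ⟨n, q, hq⟩ := Module.Finite.exists_fin' R X
    have hi := Submodule.subtype_injective (LinearMap.ker q)
    have hex := LinearMap.exact_subtype_ker_map q
    have := (finite_projective_hom (R := R) (P := Fin n → R) hS).2
    -- Since `Ext^1(X, U) = 0`, the free presentation stays short exact under `Hom(-, U)`, and its
    -- middle term becomes projective over `S`.
    refine extZ_contra_left (lcomp_injective hq) (lcomp_exact hex hq) (fun φ => ?_)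
      (extZ_of_projective j) (ih (LinearMap.ker q)
        (fun i => extZ_contra_left hi hex hq (extZ_of_projective i) (hX (i + 1)))
        (j + 1) (by omega))
    exact exists_extend_of_extZ hi hex hq (hX 0) φ

/-- Vanishing of `Ext^1(M, U)` and `Ext^2(M, U)` identifies the transpose with `Hom(ker p.d, U)`,
the dual of the second syzygy, to which `extZ_hom_of_extZ` applies. -/
theorem extZ_transpose [IsNoetherianRing R] (hS : Function.Bijective fun s : S => s • u₀) {g : ℕ}
    (hg : ∀ (X : ModuleCat.{u} S) (n), g < n → ExtZ S X U n)
    (hM : ∀ i, ExtZ R M U (i + 1)) (p : MinProjPresentation R M) (j : ℕ) :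
    ExtZ S (Transpose S U p) U (j + 1) := by
  have := p.finite₀
  have := p.finite₁
  have := p.projective₀
  have := p.projective₁
  have hΩ : ∀ i, ExtZ R (LinearMap.range p.d) U (i + 1) := fun i =>
    extZ_contra_left (f := (LinearMap.range p.d).subtype) (g := p.π)
      (Submodule.subtype_injective _) (LinearMap.exact_iff.2 (by
        rw [Submodule.range_subtype, ← LinearMap.exact_iff.1 p.exact]))
      p.π_surjective (extZ_of_projective i) (hM (i + 1))
  have hi := Submodule.subtype_injective (LinearMap.ker p.d)
  have hex : Function.Exact (LinearMap.ker p.d).subtype p.d.rangeRestrict :=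
    fun x => by simp [Subtype.ext_iff]
  have hs := p.d.surjective_rangeRestrict
  have hΩ' : ∀ i, ExtZ R (LinearMap.ker p.d) U (i + 1) := fun i =>
    extZ_contra_left hi hex hs (extZ_of_projective i) (hΩ (i + 1))
  have hres : Function.Surjective (LinearMap.lcomp S U (LinearMap.ker p.d).subtype) := fun φ =>
    exists_extend_of_extZ hi hex hs (hΩ 0) φ
  have hker : LinearMap.range (LinearMap.lcomp S U p.d) =
      LinearMap.ker (LinearMap.lcomp S U (LinearMap.ker p.d).subtype) := by
    refine le_antisymm ?_ fun φ hφ => ?_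
    · rintro _ ⟨φ, rfl⟩
      refine LinearMap.ext fun x => ?_
      change φ (p.d x) = 0
      rw [LinearMap.mem_ker.1 x.2, map_zero]
    · obtain ⟨ψ, rfl⟩ := (lcomp_exact (S := S) hex hs φ).1 hφ
      obtain ⟨χ, hχ⟩ := exists_extend_of_extZ (f := (LinearMap.range p.d).subtype) (g := p.π)
        (Submodule.subtype_injective _) (LinearMap.exact_iff.2 (by
          rw [Submodule.range_subtype, ← LinearMap.exact_iff.1 p.exact]))
        p.π_surjective (hM 0) ψ
      refine ⟨χ, LinearMap.ext fun x => ?_⟩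
      exact LinearMap.congr_fun hχ (p.d.rangeRestrict x)
  let E : Transpose S U p ≃ₗ[S] (LinearMap.ker p.d →ₗ[R] U) :=
    (Submodule.quotEquivOfEq _ _ hker).trans (LinearMap.quotKerEquivOfSurjective _ hres)
  exact extZ_congr E.symm (LinearEquiv.refl S U)
    (extZ_hom_of_extZ hS hg g (LinearMap.ker p.d) hΩ' j (by omega))

theorem isGProj_of_extZ [IsNoetherianRing R] (hS : Function.Bijective fun s : S => s • u₀) {g : ℕ}
    (hg : ∀ (X : ModuleCat.{u} S) (n), g < n → ExtZ S X U n)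
    (hM : ∀ i, ExtZ R M U (i + 1)) (p : MinProjPresentation R M) : IsGProj R M S U := by
  refine ⟨fun i hi => ?_, p, fun i hi => ?_⟩
  · obtain ⟨i, rfl⟩ := Nat.exists_eq_add_of_le' hi
    exact hM i
  · obtain ⟨i, rfl⟩ := Nat.exists_eq_add_of_le' hi
    exact extZ_transpose hS hg hM p i

/-- The two vanishing conditions that make `M → M**` bijective. -/
theorem reflexive_of_extZ_transpose (hR : Function.Bijective fun r : R => r • u₀)
    (hS : Function.Bijective fun s : S => s • u₀) (p : MinProjPresentation R M)
    (h1 : ExtZ S (Transpose S U p) U 1) (h2 : ExtZ S (Transpose S U p) U 2) :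
    (∀ x : M, (∀ f : M →ₗ[R] U, f x = 0) → x = 0) ∧
      ∀ ψ : (M →ₗ[R] U) →ₗ[S] U, ∃ x, ∀ f, ψ f = f x := by
  have := p.finite₀
  have := p.finite₁
  have := p.projective₀
  have := p.projective₁
  have := (finite_projective_hom (R := R) (P := p.P₁) hS).2
  let δ := LinearMap.lcomp S U p.d
  have hexd : Function.Exact (LinearMap.lcomp S U p.π) δ.rangeRestrict := fun φ => by
    rw [← lcomp_exact (S := S) (U := U) p.exact p.π_surjective φ]
    simp [Subtype.ext_iff, δ]
  -- `Ext^2` of the transpose controls surjectivity of `M → M**`, through `im δ`; its `Ext^1`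
  -- controls injectivity.
  have hC : ExtZ S (LinearMap.range δ) U 1 :=
    extZ_contra_left (f := (LinearMap.range δ).subtype) (g := (LinearMap.range δ).mkQ)
      (Submodule.subtype_injective _) (LinearMap.exact_subtype_mkQ _) (Submodule.mkQ_surjective _)
      (extZ_of_projective 0) h2
  constructor
  · intro x hx
    obtain ⟨y, rfl⟩ := p.π_surjective x
    obtain ⟨η, hη⟩ := exists_descend δ.surjective_rangeRestrict
      (LinearMap.applyₗ' S y : (p.P₀ →ₗ[R] U) →ₗ[S] U) fun φ hφ => by
        obtain ⟨ψ, rfl⟩ := (hexd φ).1 hφ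
        exact hx ψ
    obtain ⟨ζ, hζ⟩ := exists_extend_of_extZ (f := (LinearMap.range δ).subtype)
      (g := (LinearMap.range δ).mkQ) (Submodule.subtype_injective _)
      (LinearMap.exact_subtype_mkQ _) (Submodule.mkQ_surjective _) h1 η
    obtain ⟨q, hq⟩ := exists_eval_of_projective hR hS ζ
    have : y = p.d q := by
      rw [← sub_eq_zero]
      refine eq_zero_of_eval hR fun φ => ?_
      have e1 : φ y = ζ (φ ∘ₗ p.d) :=
        (hη φ).symm.trans (LinearMap.congr_fun hζ (δ.rangeRestrict φ)).symm
      rw [map_sub, e1, hq, LinearMap.comp_apply, sub_self]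
    rw [this, p.exact.apply_apply_eq_zero]
  · intro ψ
    obtain ⟨ψ', hψ'⟩ := exists_extend_of_extZ (lcomp_injective p.π_surjective) hexd
      δ.surjective_rangeRestrict hC ψ
    obtain ⟨y, hy⟩ := exists_eval_of_projective hR hS ψ'
    refine ⟨p.π y, fun f => ?_⟩
    rw [← hψ']
    exact hy _

/-- Generators of `M*` embed `M` into `R^n`. If `eRw` lies in the image, pairing with `w` is a
well-defined functional on `M*`; by reflexivity it is evaluation at some `x`, so `w` is the image of
`x`. Hence the cokernel is torsion-free. -/
theorem FaithfulSymmetricCorner.dom_two_of_isGProj {K : Type u} [Field K] [Algebra K R] {e : R}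
    {l : R →ₗ[K] K} (h : FaithfulSymmetricCorner K R e l) [FiniteDimensional K R]
    [IsNoetherianRing S] (hdom : Dom e 2 R) (hR : Function.Bijective fun r : R => r • u₀)
    (hS : Function.Bijective fun s : S => s • u₀) (hM : IsGProj R M S U) : Dom e 2 M := by
  obtain ⟨-, p, hp⟩ := hM
  obtain ⟨htl, hrefl⟩ := reflexive_of_extZ_transpose hR hS p (hp 1 le_rfl) (hp 2 one_le_two)
  have := p.finite₀
  have := p.projective₀
  have := (finite_projective_hom (R := R) (P := p.P₀) hS).1
  have : Module.Finite S (M →ₗ[R] U) :=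
    Module.Finite.of_injective (LinearMap.lcomp S U p.π) (lcomp_injective p.π_surjective)
  obtain ⟨n, q, hq⟩ := Module.Finite.exists_fin' S (M →ₗ[R] U)
  let t : R ≃ₗ[R] U := LinearEquiv.ofBijective (LinearMap.toSpanSingleton R U u₀) hR
  let F : Fin n → (M →ₗ[R] U) := fun k => q (Pi.single k 1)
  have hF : ∀ s : Fin n → S, q s = ∑ k, s k • F k := fun s => by
    have hs : s = ∑ k, s k • (Pi.single k 1 : Fin n → S) := by
      ext j
      simp [Finset.sum_apply, Pi.single_apply]
    conv_lhs => rw [hs, map_sum]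
    exact Finset.sum_congr rfl fun k _ => map_smul q _ _
  let j : M →ₗ[R] (Fin n → R) := LinearMap.pi fun k => t.symm.toLinearMap ∘ₗ F k
  have hj : ∀ x k, t (j x k) = F k x := fun x k => t.apply_symm_apply _
  have hinj : Function.Injective j := (injective_iff_map_eq_zero _).2 fun x hx => htl x fun f => by
    obtain ⟨s, rfl⟩ := hq f
    rw [hF, LinearMap.sum_apply]
    refine Finset.sum_eq_zero fun k _ => ?_
    rw [LinearMap.smul_apply, ← hj, hx, Pi.zero_apply, map_zero, smul_zero]
  refine (h.dom_two_pi hdom n).of_cosyzygy hinj (exact_mkQ_range j)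
    (Submodule.mkQ_surjective _) (dom_one_iff.2 fun w hw => ?_)
  obtain ⟨w, rfl⟩ := Submodule.mkQ_surjective _ w
  have ex : ∀ r, ∃ x, j x = (e * r) • w := fun r => by
    have := hw r
    rwa [← map_smul, ← LinearMap.mem_ker, Submodule.ker_mkQ] at this
  let κ : (Fin n → S) →ₗ[S] U := ∑ k, LinearMap.toSpanSingleton S U (t (w k)) ∘ₗ LinearMap.proj k
  have hκ : ∀ s, κ s = ∑ k, s k • t (w k) := fun s => by simp [κ]
  obtain ⟨ψ, hψ⟩ := exists_descend hq κ fun s hs => by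
    have hU : TorsionFree e U :=
      h.torsionFree_self.of_injective t.symm.toLinearMap t.symm.injective
    refine hU _ fun r => ?_
    obtain ⟨x, hx⟩ := ex r
    have := LinearMap.congr_fun (LinearMap.mem_ker.1 hs) x
    rw [hF, LinearMap.sum_apply] at this
    rw [hκ, Finset.smul_sum]
    refine Eq.trans ?_ this
    refine Finset.sum_congr rfl fun k _ => ?_
    rw [LinearMap.smul_apply, ← hj, hx, Pi.smul_apply, map_smul, smul_comm]
  obtain ⟨x, hx⟩ := hrefl ψ
  have hwx : w = j x := funext fun k => t.injective <| by
    rw [hj, ← hx, hψ, hκ, Finset.sum_eq_single k]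
    · simp
    · intro i _ hik
      simp [hik]
    · simp
  rw [hwx]
  simp

end Transpose

end RegularBimodule

/-! ### Consequences for both sides -/

namespace FaithfulSymmetricCorner

variable {K : Type u} [Field K] {R S : Type u} [Ring R] [Algebra K R] [Ring S] [Algebra K S]
  {e : R} {l : R →ₗ[K] K} (θ : AntiIso K R S)

theorem dom_self_dual (h : FaithfulSymmetricCorner K R e l) [FiniteDimensional K R]
    [FiniteDimensional K S] (hR : Dom e 2 R) : Dom (θ.toLinearEquiv e) 2 S :=
  (h.dual θ).dom_of_doubleCentralizer ((h.doubleCentralizer_of_dom hR).dual θ)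

/-- The cokernel `C` of `R → (Re)^m` is torsion-free, so `g < 2` already gives `Ext^1(C, R) = 0`;
the sequence splits and `R` is a summand of an injective. -/
theorem injective_self (h : FaithfulSymmetricCorner K R e l) [FiniteDimensional K R]
    (hR : Dom e 2 R) {g : ℕ} (hgR : ∀ (X : ModuleCat.{u} R) (n), g < n → ExtZ R X R n)
    (hg : g < 2) : Module.Injective R R := by
  obtain ⟨m, f, hf, hC⟩ := h.exists_cosyzygy hR
  obtain ⟨r, hr⟩ := exists_extend_of_extZ hf (exact_mkQ_range f) (Submodule.mkQ_surjective _)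
    (h.extZ_self_of_dom hgR 1 _ hC 0 hg) LinearMap.id
  exact injective_of_retract (h.injective_pi_leftIdeal m) f r hr

theorem dom_and_dom_dual_of_add (h : FaithfulSymmetricCorner K R e l) [FiniteDimensional K R]
    [FiniteDimensional K S] (hR : Dom e 2 R) {g : ℕ}
    (hgR : ∀ (X : ModuleCat.{u} R) (n), g < n → ExtZ R X R n)
    (hgS : ∀ (X : ModuleCat.{u} S) (n), g < n → ExtZ S X S n) (hg : 2 ≤ g) {a b : ℕ}
    (hab : 2 * g ≤ a + b) {M : Type u} [AddCommGroup M] [Module K M] [Module R M]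
    [IsScalarTower K R M] [FiniteDimensional K M] (hM : Dom e a M)
    (hDM : Dom (θ.toLinearEquiv e) b (DualMod θ M)) (n : ℕ) :
    Dom e n M ∧ Dom (θ.toLinearEquiv e) n (DualMod θ M) := by
  have hS := h.dom_self_dual θ hR
  rcases le_or_gt g a with ha | ha
  · exact h.dom_and_dom_dual θ hR hS hgR hgS hg (a - g) b M (hM.mono (by omega)) hDM (by omega) n
  -- Here `b > g`, so the roles of `M` and `D(M)` are exchanged.
  · have hR' : Dom (θ.symm.toLinearEquiv (θ.toLinearEquiv e)) 2 R := by
      rwa [θ.symm_apply_apply]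
    have := (h.dual θ).dom_and_dom_dual θ.symm hS hR' hgS hgR hg (b - g) a (DualMod θ M)
      (hDM.mono (by omega)) (by
        rw [θ.symm_apply_apply]
        exact hM.congr (DualMod.evalEquiv θ M)) (by omega) n
    rw [θ.symm_apply_apply] at this
    exact ⟨this.2.congr (DualMod.evalEquiv θ M).symm, this.1⟩

theorem dom_dual_of_extZ (h : FaithfulSymmetricCorner K R e l) [FiniteDimensional K R]
    [FiniteDimensional K S] (hR : Dom e 2 R) {M : Type u} [AddCommGroup M] [Module K M]
    [Module R M] [IsScalarTower K R M] [FiniteDimensional K M]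
    (hDM : Dom (θ.toLinearEquiv e) 2 (DualMod θ M)) (hM : ∀ i, ExtZ R M R (i + 1)) (n : ℕ) :
    Dom (θ.toLinearEquiv e) n (DualMod θ M) :=
  have : Module.Finite S (DualMod θ M) := Module.Finite.of_restrictScalars_finite K S _
  (h.dual θ).dom_of_extZ θ.symm (h.dom_self_dual θ hR) hDM
    (fun i => DualMod.extZ_dual θ i _ (hM i)) n

end FaithfulSymmetricCorner

/-! ### The symmetric corner of a gendo-symmetric algebra -/

section Algebras

variable {K : Type u} [Field K] {A : Type u} [Ring A] [Algebra K A]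

theorem HasBimoduleIso.faithfulSymmetricCorner [FiniteDimensional K A] {e : A}
    (he : IsIdempotentElem e) (hf : FaithfulSMul Aᵐᵒᵖ (rightIdeal A e))
    (hφ : HasBimoduleIso K A e) : ∃ l : A →ₗ[K] K, FaithfulSymmetricCorner K A e l := by
  obtain ⟨φ, hφ⟩ := hφ
  have hee : e * e = e := he
  let ι : A →ₗ[K] leftIdeal A e :=
    ((LinearMap.toSpanSingleton A A e).codRestrict (leftIdeal A e) fun x => ⟨x, rfl⟩).restrictScalars
      K
  let e' : rightIdeal A e := ⟨e, 1, (mul_one e).symm⟩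
  -- The form is `φ(e)` evaluated on `ae`; compatibility of `φ` with both actions yields `φ y z = l
  -- (y * z)` and the symmetry of `l`.
  let l : A →ₗ[K] K := φ e' ∘ₗ ι
  have hι : ∀ z : leftIdeal A e, ι z = z := by
    rintro ⟨_, a, rfl⟩
    exact Subtype.ext (by
      change a * e * e = a * e
      rw [mul_assoc, hee])
  have hy : ∀ y : rightIdeal A e, e * (y : A) = y := by
    rintro ⟨_, a, rfl⟩
    simp [← mul_assoc, hee]
  have key : ∀ (y : rightIdeal A e) (z : leftIdeal A e), φ y z = l (y * z) := fun y z => by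
    have h1 : rightIdeal.act 1 e' (y : A) = y := Subtype.ext (by
      simp [rightIdeal.act, e', hee, hy])
    have h2 : leftIdeal.act (y : A) z 1 = ι (y * z) := Subtype.ext (by
      change (y : A) * z * (e * 1 * e) = y * z * e
      rw [mul_one, hee])
    rw [← congrArg (fun w => φ w z) h1, hφ, h2]
    rfl
  have mul_e : ∀ a, l (a * e) = l a := fun a => by
    have : ι (a * e) = ι a := hι ⟨a * e, a, rfl⟩
    simp [l, this]
  have e_mul : ∀ a, l (e * a) = l a := fun a => by
    have h1 := key e' (ι a)
    have h2 : l (e * (ι a : A)) = l (e * a) := by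
      rw [show ((ι a : leftIdeal A e) : A) = a * e from rfl, ← mul_assoc, mul_e]
    rw [← h2, ← h1]
    rfl
  have nondeg_right : ∀ y, (∀ r, l (y * r) = 0) → e * y = 0 := fun y h => by
    have : (⟨e * y, y, rfl⟩ : rightIdeal A e) = 0 := φ.injective <| LinearMap.ext fun z => by
      rw [key, mul_assoc, e_mul, h, map_zero, LinearMap.zero_apply]
    exact congrArg Subtype.val this
  have faithful_left : ∀ a, (∀ b, e * b * a = 0) → a = 0 := fun a ha => by
    have : MulOpposite.op a = 0 := hf.eq_of_smul_eq_smul (α := rightIdeal A e) fun y => by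
      obtain ⟨_, b, rfl⟩ := y
      exact Subtype.ext (by simpa using ha b)
    simpa using this
  refine ⟨l, hee, mul_e, e_mul, fun x y => ?_, fun ψ hψ => ?_, fun ψ hψ => ?_, fun z hz => ?_,
    nondeg_right, faithful_left, fun a ha => ?_⟩
  · have h1 : φ (rightIdeal.act x e' 1) (ι y) = l (x * e * y) := by
      rw [key]
      change l (e * x * e * e * 1 * (y * e)) = _
      rw [mul_one, mul_assoc (e * x), hee, ← mul_assoc, mul_e, mul_assoc e x, mul_assoc e, e_mul]
    have h2 : leftIdeal.act 1 (ι y) x = ι (y * e * x) := Subtype.ext (by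
      change 1 * (y * e) * (e * x * e) = y * e * x * e
      rw [one_mul, ← mul_assoc, ← mul_assoc, mul_assoc y e e, hee])
    rw [← h1, hφ, h2]
    rfl
  · obtain ⟨z, hz⟩ := (Module.evalEquiv K (leftIdeal A e)).surjective
      (ψ ∘ₗ ((rightIdeal A e).subtype.restrictScalars K) ∘ₗ φ.symm.toLinearMap)
    refine ⟨z, fun r => ?_⟩
    have := LinearMap.congr_fun hz (φ ⟨e * r, r, rfl⟩)
    rw [Module.evalEquiv_apply, Module.Dual.eval_apply, key, mul_assoc, e_mul] at this
    rw [this]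
    simp [hψ]
  · obtain ⟨y, hy⟩ := φ.surjective (ψ ∘ₗ ((leftIdeal A e).subtype.restrictScalars K))
    refine ⟨y, fun r => ?_⟩
    have := LinearMap.congr_fun hy (ι r)
    rw [key] at this
    rw [← mul_e, mul_assoc]
    refine Eq.trans ?_ this.symm
    exact (hψ r).symm
  · have : (ι z : leftIdeal A e) = 0 := (Module.forall_dual_apply_eq_zero_iff K _).1 fun ψ => by
      obtain ⟨y, rfl⟩ := φ.surjective ψ
      rw [key]
      change l (y * (z * e)) = 0
      rw [← mul_assoc, mul_e, hz]
    exact congrArg Subtype.val this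
  -- If `aAe = 0`, then `l (b * a * r) = 0` for all `r`, so `eAa = 0`: faithfulness passes from `eA`
  -- to `Ae`.
  · refine faithful_left a fun b => ?_
    rw [mul_assoc]
    refine nondeg_right _ fun r => ?_
    rw [← mul_e, mul_assoc b, mul_assoc b, ha, mul_zero, map_zero]

theorem bijective_smul_one : Function.Bijective fun s : A => s • (1 : A) :=
  ⟨fun a b hab => by simpa using hab, fun b => ⟨b, mul_one b⟩⟩

theorem bijective_op_smul_one : Function.Bijective fun r : Aᵐᵒᵖ => r • (1 : A) := by
  simpa using MulOpposite.unop_bijective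

variable (A) in
/-- The right regular module as a left module over the opposite algebra. -/
noncomputable def regularEquiv : A ≃ₗ[Aᵐᵒᵖ] Aᵐᵒᵖ :=
  (LinearEquiv.ofBijective (LinearMap.toSpanSingleton Aᵐᵒᵖ A 1) bijective_op_smul_one).symm

variable (K) in
/-- The duality of right modules in terms of the anti-isomorphism `Aᵐᵒᵖ → A`. -/
def dualEquiv (M : Type u) [AddCommGroup M] [Module K M] [Module Aᵐᵒᵖ M] [IsScalarTower K Aᵐᵒᵖ M] :
    D K M ≃ₗ[A] DualMod (AntiIso.op K A).symm M where
  toFun f := f.toLin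
  invFun f := f.toDual
  map_add' _ _ := rfl
  map_smul' _ _ := rfl
  left_inv _ := rfl
  right_inv _ := rfl

end Algebras

end GendoSymm

/-! ### The equivalences -/

open GendoSymm in
theorem mainTheorem12 (K : Type u) [Field K] (A : Type u) [Ring A] [Algebra K A]
    [FiniteDimensional K A]
    (hA : GendoSymm.IsGendoSymmetric K A) (hns : ¬ GendoSymm.IsSelfinjective A)
    (g : ℕ) (hg : GendoSymm.IsGorensteinOfDim A g)
    (M : Type u) [AddCommGroup M] [Module K M] [Module Aᵐᵒᵖ M] [IsScalarTower K Aᵐᵒᵖ M]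
    [FiniteDimensional K M] :
    List.TFAE
      [GendoSymm.IsGorensteinProjectiveInjective K A M,
        ((2 * g : ℕ) : ℕ∞) ≤ GendoSymm.domdim Aᵐᵒᵖ M + GendoSymm.codomdim K A M,
        ((2 * g : ℕ) : ℕ∞) ≤ GendoSymm.domdim Aᵐᵒᵖ M,
        ((2 * g : ℕ) : ℕ∞) ≤ GendoSymm.codomdim K A M] := by
  have : FiniteDimensional K Aᵐᵒᵖ := Module.Finite.equiv (MulOpposite.opLinearEquiv K)
  have := isNoetherianRing_of_finiteDimensional K (R := A)
  have := isNoetherianRing_of_finiteDimensional K (R := Aᵐᵒᵖ)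
  obtain ⟨h2, e, he, hmf, -, -, hφ⟩ := hA
  obtain ⟨l, hl⟩ := hφ.faithfulSymmetricCorner he hmf.1
  have h := hl.dual (AntiIso.op K A)
  let θ := (AntiIso.op K A).symm
  have : Module.Finite Aᵐᵒᵖ A := Module.Finite.equiv (regularEquiv A).symm
  have : Module.Finite Aᵐᵒᵖ M := Module.Finite.of_restrictScalars_finite K _ _
  have : Module.Finite A (DualMod θ M) := Module.Finite.of_restrictScalars_finite K _ _
  have : Module.Finite A (D K M) := Module.Finite.equiv (dualEquiv K M).symm
  have hR := ((h.le_domdim_iff 2).1 h2).congr (regularEquiv A)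
  have hS : Dom e 2 A := h.dom_self_dual θ hR
  have hgU : ∀ (X : ModuleCat.{u} Aᵐᵒᵖ) (n), g < n → ExtZ Aᵐᵒᵖ X A n := fun X n hn =>
    extZ_of_injectiveDimension_le hg.right X hn
  have hgR : ∀ (X : ModuleCat.{u} Aᵐᵒᵖ) (n), g < n → ExtZ Aᵐᵒᵖ X Aᵐᵒᵖ n := fun X n hn =>
    extZ_congr (LinearEquiv.refl _ _) (regularEquiv A) (hgU X n hn)
  have hgS : ∀ (X : ModuleCat.{u} A) (n), g < n → ExtZ A X A n := fun X n hn =>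
    extZ_of_injectiveDimension_le hg.left X hn
  have hg2 : 2 ≤ g := by
    by_contra hlt
    exact hns (injective_of_retract (h.injective_self hR hgR (not_le.1 hlt))
      (regularEquiv A).toLinearMap (regularEquiv A).symm.toLinearMap
      (LinearMap.ext (regularEquiv A).symm_apply_apply))
  have hdom : ∀ n : ℕ, (n : ℕ∞) ≤ domdim Aᵐᵒᵖ M ↔ Dom (MulOpposite.op e) n M := h.le_domdim_iff
  have hcod : ∀ n : ℕ, (n : ℕ∞) ≤ codomdim K A M ↔ Dom e n (DualMod θ M) := fun n =>
    (hl.le_domdim_iff n).trans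
      ⟨fun H => H.congr (dualEquiv K M), fun H => H.congr (dualEquiv K M).symm⟩
  -- All four conditions are compared with `P`: both dimensions are infinite.
  let P : Prop := ∀ n, Dom (MulOpposite.op e) n M ∧ Dom e n (DualMod θ M)
  have main : ∀ a b : ℕ, 2 * g ≤ a + b → (a : ℕ∞) ≤ domdim Aᵐᵒᵖ M → (b : ℕ∞) ≤ codomdim K A M →
      P := fun a b hab ha hb =>
    h.dom_and_dom_dual_of_add θ hR hgR hgS hg2 hab ((hdom a).1 ha) ((hcod b).1 hb)
  have h13 : IsGorensteinProjectiveInjective K A M → P := by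
    rintro ⟨hp, hi⟩ n
    have hM2 := h.dom_two_of_isGProj hR bijective_op_smul_one bijective_smul_one hp
    have hDM2 := (hl.dom_two_of_isGProj hS bijective_smul_one bijective_op_smul_one hi).congr
      (dualEquiv K M)
    constructor
    · refine h.dom_of_extZ θ hR hM2 (fun i => ?_) n
      exact extZ_congr (LinearEquiv.refl _ _) (DualMod.evalEquiv θ M).symm
        (DualMod.extZ_dual θ.symm i _
          (extZ_congr (dualEquiv K M) (LinearEquiv.refl A A) (hi.1 (i + 1) (by omega))))
    · exact h.dom_dual_of_extZ θ hR hDM2 (fun i =>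
        extZ_congr (LinearEquiv.refl _ _) (regularEquiv A) (hp.1 (i + 1) (by omega))) n
  have h31 : P → IsGorensteinProjectiveInjective K A M := by
    intro hP
    obtain ⟨p⟩ := exists_minProjPresentation K M (R := Aᵐᵒᵖ)
    obtain ⟨q⟩ := exists_minProjPresentation K (D K M) (R := A)
    refine ⟨isGProj_of_extZ bijective_smul_one hgS (fun i => ?_) p,
      isGProj_of_extZ bijective_op_smul_one hgU (fun i => ?_) q⟩
    · exact extZ_congr (LinearEquiv.refl _ _) (regularEquiv A).symm
        (h.extZ_self_of_dom hgR g M (hP g).1 i (by omega))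
    · exact extZ_congr (dualEquiv K M).symm (LinearEquiv.refl _ _)
        (hl.extZ_self_of_dom hgS g (DualMod θ M) (hP g).2 i (by omega))
  tfae_have 1 → 3 := fun H => (hdom _).2 (h13 H (2 * g)).1
  tfae_have 1 → 4 := fun H => (hcod _).2 (h13 H (2 * g)).2
  tfae_have 3 → 2 := fun H => H.trans le_self_add
  tfae_have 4 → 2 := fun H => H.trans le_add_self
  tfae_have 2 → 1 := by
    intro H
    refine h31 ?_
    -- An infinite dimension is replaced by the finite bound `2 * g`, with `0` for the other one.
    rcases eq_or_ne (domdim Aᵐᵒᵖ M) ⊤ with ht | ht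
    · exact main (2 * g) 0 le_rfl (ht ▸ le_top) (by simp)
    rcases eq_or_ne (codomdim K A M) ⊤ with ht' | ht'
    · exact main 0 (2 * g) (by omega) (by simp) (ht' ▸ le_top)
    obtain ⟨a, ha⟩ := ENat.ne_top_iff_exists.1 ht
    obtain ⟨b, hb⟩ := ENat.ne_top_iff_exists.1 ht'
    rw [← ha, ← hb] at H
    exact main a b (by exact_mod_cast H) ha.le hb.le
  tfae_finish
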